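/- **Conventions.** Smooth manifolds are finite-dimensional (of one fixed dimension each), Hausdorff and second countable, and are regarded as diffeological spaces whose plots are the smooth maps; subsets carry the subset diffeology, products the product diffeology, and "open" refers to the D-topology. A smooth map $f\colon X\to Y$ of diffeological spaces is a *local subduction* if for every plot $\phi\colon U\to Y$, $u\in U$ and $x\in X$ with $\phi(u)=f(x)$ there are an open neighbourhood $V\subset U$ of $u$ and a plot $\tilde\phi\colon V\to X$ with $\tilde\phi(u)=x$ and $f\circ\tilde\phi=\phi|_V$. A subset is *totally disconnected* if every plot of it is locally constant. A map $\pi\colon X\to Y$ is *quasi-étale* if it is a local subduction, its fibers are totally disconnected, and every smooth $f\colon\mathcal O\to X$ with $\mathcal O\subset X$ open and $\pi\circ f=\pi|_{\mathcal O}$ is a local diffeomorphism. A diffeological space $X$ is a *QUED* if every point of $X$ is in the image of a *quasi-étale chart*, i.e. a quasi-étale map from a smooth manifold to $X$; $\mathbf{QUED}$ is the full subcategory of diffeological spaces on these. A *$\mathbf{QUED}$-submersion* is a morphism $p\colon X\to Z$ of $\mathbf{QUED}$ that is a local subduction and is cartesian: for each $f\colon Y\to Z$ in $\mathbf{QUED}$,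 either the fiber product of $p$ and $f$ exists in $\mathbf{QUED}$, or there is no commutative square in $\mathbf{QUED}$ over $p$ and $f$. A *diffeological groupoid* $\mathcal G\rightrightarrows M$ is a groupoid whose arrows and objects form diffeological spaces and whose structure maps $s,t,\mathrm u,m,i$ are smooth, $m(g,h)=gh$ being defined when $s(g)=t(h)$. It is a *$\mathbf{QUED}$-groupoid* if $\mathcal G$ and $M$ are QUEDs and $s,t$ are $\mathbf{QUED}$-submersions. A *local $\mathbf{QUED}$-groupoid* $\mathcal G\rightrightarrows X$ consists of QUEDs $\mathcal G,X$, $\mathbf{QUED}$-submersions $s,t\colon\mathcal G\to X$, a smooth unit map $\mathrm u\colon X\to\mathcal G$, a smooth multiplication defined on an open neighbourhood of the pairs of units in $\mathcal G\times_{s,t}\mathcal G$, and a smooth inversion $i$ defined on an open neighbourhood of the units in $\mathcal G$, such that $s(\mathrm u(x))=t(\mathrm u(x))=x$, $s(gh)=s(h)$, $t(gh)=t(g)$, $s(i(g))=t(g)$, and such that the unit, inverse and associativity laws hold whenever both sides are defined. It is a *singular local Lie groupoid* if $X$ is a smooth manifold, and a *local Lie groupoid* if both $\mathcal G$ and $X$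 are. The germ $[F]$ around the units of a smooth map $F$ between local groupoids is a *local homomorphism covering $f$* if $F$ maps units to units and, on some open neighbourhood of the units, $s\circ F=f\circ s$, $t\circ F=f\circ t$, and $F(gh)=F(g)F(h)$ whenever these expressions are defined; a diffeological groupoid counts as a local one with everywhere defined operations. A *wide local Lie groupoid chart* of a singular local Lie groupoid $\mathcal G\rightrightarrows M$ is a quasi-étale map $\pi\colon\widetilde{\mathcal G}\to\mathcal G$ from a local Lie groupoid $\widetilde{\mathcal G}\rightrightarrows M$ such that $[\pi]$ is a local homomorphism covering the identity of $M$. **Theorem.** Let $\mathcal G\rightrightarrows M$ be a diffeological groupoid over a smooth manifold $M$ whose source map is a local subduction. Let $\widetilde{\mathcal G}\rightrightarrows M$ be a local Lie groupoid over the same manifold and let $\pi\colon\widetilde{\mathcal G}\to\mathcal G$ be a local subduction such that $[\pi]$ is a local homomorphism covering the identity of $M$. If for every unit element $u\in\mathcal G$ the fiber $\pi^{-1}(u)\subset\widetilde{\mathcal G}$ is totally disconnected, then $\mathcal G\rightrightarrows M$ is a $\mathbf{QUED}$-groupoid and $\pi$ is a wide local Lie groupoid chart of $\mathcal G\rightrightarrows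 M$. -/

import Mathlib

open scoped Manifold ContDiff Topology
open Diffeology CategoryTheory CategoryTheory.Limits

universe u

section Constructions

/-- The pullback diffeology along `f`: a map `p` is a plot iff `f ∘ p` is a plot. -/
@[reducible]
def DiffeologicalSpace.pullback {X Y : Type*} (f : X → Y) (dY : DiffeologicalSpace Y) :
    DiffeologicalSpace X where
  plots _ := {p | IsPlot (f ∘ p)}
  constant_plots x := DiffeologicalSpace.constant_plots (f x)
  plot_reparam hp hf := isPlot_reparam hp hf
  locality hp := DiffeologicalSpace.locality (X := Y) hp

/-- The subset diffeology. -/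
instance Subtype.instDiffeologicalSpace {X : Type*} [d : DiffeologicalSpace X] {P : X → Prop} :
    DiffeologicalSpace (Subtype P) :=
  DiffeologicalSpace.pullback Subtype.val d

/-- The product diffeology: a map is a plot iff both of its components are plots. -/
instance Prod.instDiffeologicalSpace {X Y : Type*} [dX : DiffeologicalSpace X]
    [dY : DiffeologicalSpace Y] : DiffeologicalSpace (X × Y) :=
  DiffeologicalSpace.pullback Prod.fst dX ⊓ DiffeologicalSpace.pullback Prod.snd dY

end Constructions

section Diffeology

variable {X Y : Type*} [DiffeologicalSpace X] [DiffeologicalSpace Y]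

/-- Open for the D-topology. -/
def IsDOpen (s : Set X) : Prop := IsOpen[Diffeology.dTopology] s

/-- Diffeomorphisms of diffeological spaces. -/
def IsDDiffeomorphism (f : X → Y) : Prop :=
  DSmooth f ∧ ∃ g : Y → X, DSmooth g ∧ Function.LeftInverse g f ∧ Function.RightInverse g f

/-- Local diffeomorphisms: each point has an open neighbourhood that is mapped diffeomorphically
onto an open subset of the codomain. -/
def IsLocalDDiffeomorphism (f : X → Y) : Prop :=
  ∀ x : X, ∃ (V : Set X) (W : Set Y), IsDOpen V ∧ IsDOpen W ∧ x ∈ V ∧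
    ∃ h : Set.MapsTo f V W, IsDDiffeomorphism (h.restrict f V W)

/-- A subset is totally disconnected if its subset diffeology is discrete, that is, if every plot
of the subset is locally constant. -/
def IsDTotallyDisconnected (s : Set X) : Prop :=
  ∀ (n : ℕ) (p : EuclideanSpace ℝ (Fin n) → s), IsPlot p → IsLocallyConstant p

/-- Local subductions: smooth maps along which every plot of the codomain lifts locally, through
any prescribed point over the value of the plot. -/
def IsLocalSubduction (f : X → Y) : Prop :=
  DSmooth f ∧
    ∀ (n : ℕ) (p : EuclideanSpace ℝ (Fin n) → Y), IsPlot p →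
      ∀ (v : EuclideanSpace ℝ (Fin n)) (x : X), p v = f x →
        ∃ (V : Set (EuclideanSpace ℝ (Fin n))) (hv : v ∈ V) (q : V → X),
          IsOpen V ∧ DSmooth q ∧ q ⟨v, hv⟩ = x ∧ ∀ w : V, f (q w) = p w

/-- Quasi-étale maps. -/
structure IsQuasiEtale (π : X → Y) : Prop where
  isLocalSubduction : IsLocalSubduction π
  totallyDisconnected_fibers : ∀ y : Y, IsDTotallyDisconnected (π ⁻¹' {y})
  rigid : ∀ O : Set X, IsDOpen O → ∀ f : O → X, DSmooth f → (∀ x : O, π (f x) = π x) →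
    IsLocalDDiffeomorphism f

/-- The diffeological space `X` is a smooth manifold (finite-dimensional of some fixed dimension,
Hausdorff, second countable): it carries a manifold structure whose smooth maps from Euclidean
spaces are exactly the plots. -/
def IsSmoothManifold (X : Type*) [DiffeologicalSpace X] : Prop :=
  ∃ (d : ℕ) (_ : TopologicalSpace X) (_ : ChartedSpace (EuclideanSpace ℝ (Fin d)) X),
    T2Space X ∧ SecondCountableTopology X ∧ IsManifold (𝓡 d) ∞ X ∧
    ∀ (n : ℕ) (p : EuclideanSpace ℝ (Fin n) → X), IsPlot p ↔ ContMDiff (𝓡 n) (𝓡 d) ∞ p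

/-- Quasi-étale diffeological spaces: every point is in the image of a quasi-étale chart, that is,
of a quasi-étale map from a smooth manifold. -/
def IsQUED (X : Type u) [DiffeologicalSpace X] : Prop :=
  ∀ x : X, ∃ (N : Type u) (_ : DiffeologicalSpace N) (π : N → X),
    IsSmoothManifold N ∧ IsQuasiEtale π ∧ x ∈ Set.range π

end Diffeology

section Categories

/-- A morphism `p : X ⟶ Z` is cartesian if, for every `f : Y ⟶ Z`, either the fibre product of `p`
and `f` exists or no commutative square over `p` and `f` exists. -/
def IsCartesianMorphism {C : Type*} [Category C] {X Z : C} (p : X ⟶ Z) : Prop :=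
  ∀ (Y : C) (f : Y ⟶ Z), HasPullback p f ∨
    ¬ ∃ (W : C) (a : W ⟶ X) (b : W ⟶ Y), a ≫ p = b ≫ f

/-- The objects of the category of diffeological spaces. -/
structure Diffgl : Type (u + 1) where
  carrier : Type u
  [str : DiffeologicalSpace carrier]

attribute [instance] Diffgl.str

/-- The morphisms of the category of diffeological spaces: smooth maps. -/
@[ext]
structure Diffgl.Hom (X Y : Diffgl.{u}) where
  toFun : X.carrier → Y.carrier
  smooth : DSmooth toFun

instance : Category Diffgl.{u} where
  Hom X Y := Diffgl.Hom X Y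
  id _ := ⟨id, dSmooth_id⟩
  comp f g := ⟨g.toFun ∘ f.toFun, g.smooth.comp f.smooth⟩

/-- The category of quasi-étale diffeological spaces, a full subcategory. -/
abbrev QUED : Type (u + 1) :=
  ObjectProperty.FullSubcategory (fun X : Diffgl.{u} => IsQUED X.carrier)

/-- A quasi-étale diffeological space as an object of the category. -/
def QUED.of (X : Type u) [DiffeologicalSpace X] (hX : IsQUED X) : QUED.{u} :=
  ⟨⟨X⟩, hX⟩

/-- A smooth map of quasi-étale diffeological spaces as a morphism of the category. -/
def QUED.ofHom {X Y : Type u} [DiffeologicalSpace X] [DiffeologicalSpace Y] (hX : IsQUED X)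
    (hY : IsQUED Y) (f : X → Y) (hf : DSmooth f) : QUED.of X hX ⟶ QUED.of Y hY :=
  ObjectProperty.homMk ⟨f, hf⟩

/-- `QUED`-submersions: morphisms of `QUED` that are local subductions and cartesian. -/
def IsQUEDSubmersion {X Z : Type u} [DiffeologicalSpace X] [DiffeologicalSpace Z] (p : X → Z) :
    Prop :=
  ∃ (hX : IsQUED X) (hZ : IsQUED Z) (hp : DSmooth p),
    IsLocalSubduction p ∧ IsCartesianMorphism (QUED.ofHom hX hZ p hp)

end Categories

/-- The fibre product of `p` and `q`, with the subset diffeology of the product diffeology. -/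
abbrev FiberProd {X Y Z : Type*} (p : X → Z) (q : Y → Z) : Type _ :=
  {a : X × Y // p a.1 = q a.2}

/-- A diffeological groupoid with arrows `G` and objects `M`: a groupoid with smooth structure
maps. The product `g h` is defined when `src g = tgt h`. -/
structure DiffeologicalGroupoid (G M : Type*) [DiffeologicalSpace G] [DiffeologicalSpace M] where
  src : G → M
  tgt : G → M
  unit : M → G
  mul : FiberProd src tgt → G
  inv : G → G
  smooth_src : DSmooth src
  smooth_tgt : DSmooth tgt
  smooth_unit : DSmooth unit
  smooth_mul : DSmooth mul
  smooth_inv : DSmooth inv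
  src_unit : ∀ x, src (unit x) = x
  tgt_unit : ∀ x, tgt (unit x) = x
  src_mul : ∀ a : FiberProd src tgt, src (mul a) = src a.1.2
  tgt_mul : ∀ a : FiberProd src tgt, tgt (mul a) = tgt a.1.1
  src_inv : ∀ g, src (inv g) = tgt g
  tgt_inv : ∀ g, tgt (inv g) = src g
  unit_mul : ∀ g, mul ⟨(unit (tgt g), g), src_unit (tgt g)⟩ = g
  mul_unit : ∀ g, mul ⟨(g, unit (src g)), (tgt_unit (src g)).symm⟩ = g
  mul_inv : ∀ g, mul ⟨(g, inv g), (tgt_inv g).symm⟩ = unit (tgt g)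
  inv_mul : ∀ g, mul ⟨(inv g, g), src_inv g⟩ = unit (src g)
  assoc : ∀ (g h k : G) (e : src g = tgt h) (e' : src h = tgt k),
    mul ⟨(g, mul ⟨(h, k), e'⟩), e.trans (tgt_mul ⟨(h, k), e'⟩).symm⟩ =
      mul ⟨(mul ⟨(g, h), e⟩, k), (src_mul ⟨(g, h), e⟩).trans e'⟩

/-- A local diffeological groupoid with arrows `G` and objects `X`: multiplication is defined on an
open neighbourhood `mulDom` of the pairs of units in the space of composable pairs, inversion on an
open neighbourhood `invDom` of the units, and the groupoid laws hold whenever both sides are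
defined. -/
structure LocalDiffeologicalGroupoid (G X : Type*) [DiffeologicalSpace G]
    [DiffeologicalSpace X] where
  src : G → X
  tgt : G → X
  unit : X → G
  mulDom : Set (FiberProd src tgt)
  mul : mulDom → G
  invDom : Set G
  inv : invDom → G
  smooth_src : DSmooth src
  smooth_tgt : DSmooth tgt
  smooth_unit : DSmooth unit
  isDOpen_mulDom : IsDOpen mulDom
  unit_mem_mulDom : ∀ (x y : X) (e : src (unit x) = tgt (unit y)),
    (⟨(unit x, unit y), e⟩ : FiberProd src tgt) ∈ mulDom
  smooth_mul : DSmooth mul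
  isDOpen_invDom : IsDOpen invDom
  unit_mem_invDom : ∀ x, unit x ∈ invDom
  smooth_inv : DSmooth inv
  src_unit : ∀ x, src (unit x) = x
  tgt_unit : ∀ x, tgt (unit x) = x
  src_mul : ∀ a : mulDom, src (mul a) = src a.1.1.2
  tgt_mul : ∀ a : mulDom, tgt (mul a) = tgt a.1.1.1
  src_inv : ∀ g : invDom, src (inv g) = tgt g.1
  unit_mul : ∀ (g : G) (e : src (unit (tgt g)) = tgt g) (m : ⟨(unit (tgt g), g), e⟩ ∈ mulDom),
    mul ⟨⟨(unit (tgt g), g), e⟩, m⟩ = g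
  mul_unit : ∀ (g : G) (e : src g = tgt (unit (src g))) (m : ⟨(g, unit (src g)), e⟩ ∈ mulDom),
    mul ⟨⟨(g, unit (src g)), e⟩, m⟩ = g
  mul_inv : ∀ (g : invDom) (e : src g.1 = tgt (inv g)) (m : ⟨(g.1, inv g), e⟩ ∈ mulDom),
    mul ⟨⟨(g.1, inv g), e⟩, m⟩ = unit (tgt g.1)
  inv_mul : ∀ (g : invDom) (e : src (inv g) = tgt g.1) (m : ⟨(inv g, g.1), e⟩ ∈ mulDom),
    mul ⟨⟨(inv g, g.1), e⟩, m⟩ = unit (src g.1)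
  assoc : ∀ (g h k : G) (e₁ : src g = tgt h) (m₁ : ⟨(g, h), e₁⟩ ∈ mulDom)
    (e₂ : src h = tgt k) (m₂ : ⟨(h, k), e₂⟩ ∈ mulDom)
    (e₃ : src g = tgt (mul ⟨⟨(h, k), e₂⟩, m₂⟩))
    (m₃ : ⟨(g, mul ⟨⟨(h, k), e₂⟩, m₂⟩), e₃⟩ ∈ mulDom)
    (e₄ : src (mul ⟨⟨(g, h), e₁⟩, m₁⟩) = tgt k)
    (m₄ : ⟨(mul ⟨⟨(g, h), e₁⟩, m₁⟩, k), e₄⟩ ∈ mulDom),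
    mul ⟨⟨(g, mul ⟨⟨(h, k), e₂⟩, m₂⟩), e₃⟩, m₃⟩ = mul ⟨⟨(mul ⟨⟨(g, h), e₁⟩, m₁⟩, k), e₄⟩, m₄⟩

theorem isDOpen_univ_diffeology {X : Type*} [DiffeologicalSpace X] :
    IsDOpen (Set.univ : Set X) :=
  @isOpen_univ X Diffeology.dTopology

/-- A diffeological groupoid, regarded as a local one. -/
def DiffeologicalGroupoid.toLocal {G M : Type*} [DiffeologicalSpace G] [DiffeologicalSpace M]
    (𝒢 : DiffeologicalGroupoid G M) : LocalDiffeologicalGroupoid G M where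
  src := 𝒢.src
  tgt := 𝒢.tgt
  unit := 𝒢.unit
  mulDom := Set.univ
  mul a := 𝒢.mul a.1
  invDom := Set.univ
  inv g := 𝒢.inv g.1
  smooth_src := 𝒢.smooth_src
  smooth_tgt := 𝒢.smooth_tgt
  smooth_unit := 𝒢.smooth_unit
  isDOpen_mulDom := isDOpen_univ_diffeology
  unit_mem_mulDom _ _ _ := Set.mem_univ _
  smooth_mul n p hp := 𝒢.smooth_mul n (Subtype.val ∘ p) hp
  isDOpen_invDom := isDOpen_univ_diffeology
  unit_mem_invDom _ := Set.mem_univ _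
  smooth_inv n p hp := 𝒢.smooth_inv n (Subtype.val ∘ p) hp
  src_unit := 𝒢.src_unit
  tgt_unit := 𝒢.tgt_unit
  src_mul a := 𝒢.src_mul a.1
  tgt_mul a := 𝒢.tgt_mul a.1
  src_inv g := 𝒢.src_inv g.1
  unit_mul g _ _ := 𝒢.unit_mul g
  mul_unit g _ _ := 𝒢.mul_unit g
  mul_inv g _ _ := 𝒢.mul_inv g.1
  inv_mul g _ _ := 𝒢.inv_mul g.1
  assoc g h k e₁ _ e₂ _ _ _ _ _ := 𝒢.assoc g h k e₁ e₂

/-- `QUED`-groupoids: the arrows and the objects form quasi-étale diffeological spaces, and source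
and target are `QUED`-submersions. -/
structure DiffeologicalGroupoid.IsQUEDGroupoid {G M : Type u} [DiffeologicalSpace G]
    [DiffeologicalSpace M] (𝒢 : DiffeologicalGroupoid G M) : Prop where
  arrows : IsQUED G
  objects : IsQUED M
  src : IsQUEDSubmersion 𝒢.src
  tgt : IsQUEDSubmersion 𝒢.tgt

namespace LocalDiffeologicalGroupoid

/-- Local `QUED`-groupoids. -/
structure IsLocalQUEDGroupoid {G X : Type u} [DiffeologicalSpace G] [DiffeologicalSpace X]
    (𝒢 : LocalDiffeologicalGroupoid G X) : Prop where
  arrows : IsQUED G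
  objects : IsQUED X
  src : IsQUEDSubmersion 𝒢.src
  tgt : IsQUEDSubmersion 𝒢.tgt

/-- Singular local Lie groupoids: local `QUED`-groupoids over a smooth manifold. -/
def IsSingularLocalLieGroupoid {G X : Type u} [DiffeologicalSpace G] [DiffeologicalSpace X]
    (𝒢 : LocalDiffeologicalGroupoid G X) : Prop :=
  𝒢.IsLocalQUEDGroupoid ∧ IsSmoothManifold X

/-- Local Lie groupoids: local `QUED`-groupoids whose arrows and objects form smooth manifolds. -/
def IsLocalLieGroupoid {G X : Type u} [DiffeologicalSpace G] [DiffeologicalSpace X]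
    (𝒢 : LocalDiffeologicalGroupoid G X) : Prop :=
  𝒢.IsLocalQUEDGroupoid ∧ IsSmoothManifold G ∧ IsSmoothManifold X

/-- The germ of `F` around the units is a morphism of local groupoids covering `f`: `F` maps units
to units and, on some open neighbourhood `W` of the units, it is smooth and compatible with source,
target and multiplication whenever the expressions involved are defined. -/
def IsGermMorphism {G X H Y : Type*} [DiffeologicalSpace G] [DiffeologicalSpace X]
    [DiffeologicalSpace H] [DiffeologicalSpace Y] (𝒢 : LocalDiffeologicalGroupoid G X)
    (ℋ : LocalDiffeologicalGroupoid H Y) (F : G → H) (f : X → Y) : Prop :=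
  Set.MapsTo F (Set.range 𝒢.unit) (Set.range ℋ.unit) ∧
  ∃ W : Set G, IsDOpen W ∧ Set.range 𝒢.unit ⊆ W ∧ DSmooth (W.domRestrict F) ∧
    (∀ g ∈ W, ℋ.src (F g) = f (𝒢.src g) ∧ ℋ.tgt (F g) = f (𝒢.tgt g)) ∧
    ∀ g ∈ W, ∀ h ∈ W, ∀ (e : 𝒢.src g = 𝒢.tgt h) (m : ⟨(g, h), e⟩ ∈ 𝒢.mulDom),
      𝒢.mul ⟨⟨(g, h), e⟩, m⟩ ∈ W →
      ∀ (e' : ℋ.src (F g) = ℋ.tgt (F h)) (m' : ⟨(F g, F h), e'⟩ ∈ ℋ.mulDom),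
        F (𝒢.mul ⟨⟨(g, h), e⟩, m⟩) = ℋ.mul ⟨⟨(F g, F h), e'⟩, m'⟩

/-- `π` is a wide local Lie groupoid chart of the singular local Lie groupoid `𝒢` over `M`: a
quasi-étale chart whose domain is a local Lie groupoid over all of `M`, and whose germ around the
units is a morphism of local groupoids covering the identity of `M`. -/
structure IsWideLocalLieGroupoidChart {G' G M : Type u} [DiffeologicalSpace G']
    [DiffeologicalSpace G] [DiffeologicalSpace M] (𝒢' : LocalDiffeologicalGroupoid G' M)
    (𝒢 : LocalDiffeologicalGroupoid G M) (π : G' → G) : Prop where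
  isSingularLocalLieGroupoid : 𝒢.IsSingularLocalLieGroupoid
  isLocalLieGroupoid : 𝒢'.IsLocalLieGroupoid
  isQuasiEtale : IsQuasiEtale π
  isGermMorphism : 𝒢'.IsGermMorphism 𝒢 π id

end LocalDiffeologicalGroupoid

/-!
The proof works with germs of plots defined on all of a Euclidean space. A chart `φ : V → X` on a
vector space is *quasi-étale at `a`* (`IsQuasiEtaleAt`) if smooth maps into the fiber through `a`
are locally constant at `a`, and every smooth self-map that fixes `a` and preserves `φ` has
invertible derivative at `a`. For local subductions from manifolds this condition in all charts is
equivalent to being quasi-étale (`IsLocalSubduction.isQuasiEtale`, `IsQuasiEtale.isQuasiEtaleAt`).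
It has two properties that reduce the theorem to a statement about units. Two charts of the same
dimension that both lift plots are quasi-étale at the same points
(`IsQuasiEtaleAt.of_liftsThrough`), and a chart fibered over a quasi-étale one is quasi-étale as
soon as its slices are (`IsQuasiEtaleAt.of_slice`).

The heart of the argument is `IsSourceChart.exists_germ_eq`. Let `e` be a self-map of the source
fiber of `G'` through a unit that fixes this unit and satisfies `π ∘ e = π`. For `q` near the units
with source the target of `x`, the element `q⁻¹ e(q x)` has image `π x` under `π`, whatever `q` is.
Its quotient by `x` thus moves in a totally disconnected unit fiber of `π` as `q` moves in a source
fiber, and hence is constant. For `q` a unit this gives `e(x)`, for `q = x⁻¹` it gives an element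
that does not depend on `e`. So `e` is the identity near the unit. The inverses used here come from
the inverse function theorem (`IsSourceChart.exists_left_inverse`).

Right translation along local sections of the source map carries charts at the units to charts
around all arrows of `G`, fibered over `M` by the source map, whose slices are quasi-étale by
comparison with translated unit slices (`HasUnitCharts.hasFiberedCharts_src`). A base change of a
fibered chart along a quasi-étale chart of `Y` is a quasi-étale chart of the fiber product with `Y`
(`HasFiberedCharts.isQUED_fiberProd`), so that the source map is cartesian; the target map follows
by inversion. Finally `π` is a local subduction from a manifold of the dimension of these charts,
and is therefore quasi-étale by comparison with them.
-/

set_option linter.unusedSectionVars false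

/-! ### Smooth maps on vector spaces and germs of plots -/

section Germs

variable {V W X Y Z : Type*}
  [NormedAddCommGroup V] [NormedSpace ℝ V] [FiniteDimensional ℝ V]
  [NormedAddCommGroup W] [NormedSpace ℝ W] [FiniteDimensional ℝ W]

/-- A total smooth map with values in a given neighbourhood of `v` that is the identity near `v`.
Precomposition with it extends germs of plots to total plots. -/
theorem exists_smooth_retraction_near (v : V) {U : Set V} (hU : U ∈ 𝓝 v) :
    ∃ ρ : V → V, ContDiff ℝ ∞ ρ ∧ (∀ w, ρ w ∈ U) ∧ ∀ᶠ w in 𝓝 v, ρ w = w := by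
  obtain ⟨ε, hε, hεU⟩ := Metric.mem_nhds_iff.1 hU
  let χ : ContDiffBump v := ⟨ε / 2, ε, half_pos hε, half_lt_self hε⟩
  refine ⟨fun w => v + χ w • (w - v), ?_, fun w => hεU ?_, ?_⟩
  · exact contDiff_const.add (χ.contDiff.smul (contDiff_id.sub contDiff_const))
  · rw [Metric.mem_ball, dist_eq_norm, add_sub_cancel_left, norm_smul,
      Real.norm_of_nonneg χ.nonneg]
    by_cases hw : w ∈ Metric.ball v ε
    · refine (mul_le_of_le_one_left (norm_nonneg _) χ.le_one).trans_lt ?_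
      rwa [← dist_eq_norm]
    · rw [χ.zero_of_le_dist (by simpa using hw), zero_mul]
      exact hε
  · filter_upwards [χ.eventuallyEq_one] with w hw
    simp [hw]

theorem exists_contDiff_eventuallyEq {f : V → W} {v : V}
    (hf : ∀ᶠ w in 𝓝 v, ContDiffAt ℝ ∞ f w) :
    ∃ g : V → W, ContDiff ℝ ∞ g ∧ ∀ᶠ w in 𝓝 v, g w = f w := by
  obtain ⟨ρ, hρ, hρU, hρv⟩ := exists_smooth_retraction_near v hf
  refine ⟨f ∘ ρ, contDiff_iff_contDiffAt.2 fun w => ?_, ?_⟩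
  · exact ContDiffAt.comp w (hρU w) hρ.contDiffAt
  · filter_upwards [hρv] with w hw
    simp [hw]

variable [DiffeologicalSpace V] [IsContDiffCompatible V]
  [DiffeologicalSpace W] [IsContDiffCompatible W]
  [DiffeologicalSpace X] [DiffeologicalSpace Y] [DiffeologicalSpace Z]

instance Prod.instIsContDiffCompatible : IsContDiffCompatible (V × W) where
  isPlot_iff {n p} := by
    rw [show IsPlot p ↔ IsPlot (Prod.fst ∘ p) ∧ IsPlot (Prod.snd ∘ p) from
      DiffeologicalSpace.isPlot_inf_iff, isPlot_iff_contDiff, isPlot_iff_contDiff]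
    exact ⟨fun h => h.1.prodMk h.2, fun h => ⟨contDiff_fst.comp h, contDiff_snd.comp h⟩⟩

theorem dSmooth_prod_iff {f : X → Y × Z} :
    DSmooth f ↔ DSmooth (Prod.fst ∘ f) ∧ DSmooth (Prod.snd ∘ f) := by
  refine ⟨fun h => ⟨fun n p hp => ?_, fun n p hp => ?_⟩, fun h n p hp => ?_⟩
  · exact (DiffeologicalSpace.isPlot_inf_iff.1 (h n p hp)).1
  · exact (DiffeologicalSpace.isPlot_inf_iff.1 (h n p hp)).2
  · exact DiffeologicalSpace.isPlot_inf_iff.2 ⟨h.1 n p hp, h.2 n p hp⟩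

theorem Diffeology.DSmooth.prodMk {f : X → Y} {g : X → Z} (hf : DSmooth f) (hg : DSmooth g) :
    DSmooth fun x => (f x, g x) :=
  dSmooth_prod_iff.2 ⟨hf, hg⟩

theorem dSmooth_fst : DSmooth (Prod.fst : X × Y → X) :=
  (dSmooth_prod_iff.1 dSmooth_id).1

theorem dSmooth_snd : DSmooth (Prod.snd : X × Y → Y) :=
  (dSmooth_prod_iff.1 dSmooth_id).2

theorem dSmooth_subtypeVal {P : X → Prop} : DSmooth (Subtype.val : Subtype P → X) :=
  fun _ _ hp => hp

theorem dSmooth_subtype_iff {P : Y → Prop} {f : X → Subtype P} :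
    DSmooth f ↔ DSmooth fun x => (f x).1 :=
  Iff.rfl

theorem IsDOpen.isOpen_preimage {s : Set X} (hs : IsDOpen s) {f : V → X} (hf : DSmooth f) :
    IsOpen (f ⁻¹' s) := by
  have h := isOpen_iff_preimages_plots.1 hs _ _
    (hf _ _ (toEuclidean (E := V)).symm.contDiff.isPlot)
  rw [Set.preimage_comp] at h
  rw [← (toEuclidean (E := V)).preimage_symm_preimage (f ⁻¹' s)]
  exact (toEuclidean (E := V)).continuous.isOpen_preimage _ h

theorem IsDOpen.eventually {s : Set X} (hs : IsDOpen s) {f : V → X} (hf : DSmooth f) {v : V}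
    (hv : f v ∈ s) : ∀ᶠ w in 𝓝 v, f w ∈ s :=
  (hs.isOpen_preimage hf).mem_nhds hv

theorem IsDOpen.preimage {s : Set Y} (hs : IsDOpen s) {f : X → Y} (hf : DSmooth f) :
    IsDOpen (f ⁻¹' s) :=
  isOpen_iff_preimages_plots.2 fun n p hp => isOpen_iff_preimages_plots.1 hs n _ (hf n p hp)

/-- Every plot with values in `S` lifts along `f` near each point, and the lift may be prescribed
at that point. The lift is a total plot, and it is a lift of the germ of the given plot. -/
def LiftsThrough (S : Set Y) (f : X → Y) : Prop :=
  ∀ (n : ℕ) (p : EuclideanSpace ℝ (Fin n) → Y), IsPlot p → (∀ w, p w ∈ S) →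
    ∀ (v : EuclideanSpace ℝ (Fin n)) (a : X), p v = f a →
      ∃ q : EuclideanSpace ℝ (Fin n) → X, IsPlot q ∧ q v = a ∧ ∀ᶠ w in 𝓝 v, f (q w) = p w

/-- A lift over a finite-dimensional space of a smooth map that takes values in `S` near the
base point. -/
theorem LiftsThrough.exists_lift {S : Set Y} {f : X → Y} (h : LiftsThrough S f) {p : V → Y}
    (hp : DSmooth p) {v : V} (hS : ∀ᶠ w in 𝓝 v, p w ∈ S) {a : X} (hv : p v = f a) :
    ∃ q : V → X, DSmooth q ∧ q v = a ∧ ∀ᶠ w in 𝓝 v, f (q w) = p w := by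
  obtain ⟨ρ, hρ, hρS, hρv⟩ := exists_smooth_retraction_near v hS
  let e := toEuclidean (E := V)
  obtain ⟨q, hq, hqv, hfq⟩ := h _ (p ∘ ρ ∘ e.symm) (hp.comp
    ((hρ.comp e.symm.contDiff).dSmooth)).isPlot (fun w => hρS _) (e v) a
    (by simpa [hρv.self_of_nhds] using hv)
  refine ⟨q ∘ e, hq.dSmooth.comp e.contDiff.dSmooth, hqv, ?_⟩
  filter_upwards [e.continuous.continuousAt.eventually hfq, hρv] with w hw hw'
  simpa [hw'] using hw

theorem IsLocalSubduction.liftsThrough {f : X → Y} (hf : IsLocalSubduction f) :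
    LiftsThrough Set.univ f := by
  intro n p hp _ v a hv
  obtain ⟨U, hvU, q, hU, hq, hqv, hfq⟩ := hf.2 n p hp v a hv
  obtain ⟨ρ, hρ, hρU, hρv⟩ := exists_smooth_retraction_near v (hU.mem_nhds hvU)
  refine ⟨fun w => q ⟨ρ w, hρU w⟩, ?_, ?_, ?_⟩
  · exact hq n (fun w => ⟨ρ w, hρU w⟩) (show IsPlot ρ from hρ.isPlot)
  · rw [← hqv]
    exact congrArg q (Subtype.ext hρv.self_of_nhds)
  · filter_upwards [hρv] with w hw
    exact (hfq _).trans (congrArg p hw)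

theorem LiftsThrough.isLocalSubduction {f : X → Y} (h : LiftsThrough Set.univ f)
    (hf : DSmooth f) : IsLocalSubduction f := by
  refine ⟨hf, fun n p hp v a hv => ?_⟩
  obtain ⟨q, hq, hqv, hfq⟩ := h n p hp (fun _ => Set.mem_univ _) v a hv
  obtain ⟨U, hUf, hU, hvU⟩ := eventually_nhds_iff.1 hfq
  exact ⟨U, hvU, fun w => q w, hU, hq.dSmooth.comp dSmooth_subtypeVal, hqv,
    fun w => hUf w w.2⟩

theorem LiftsThrough.comp {S : Set Z} {g : Y → Z} {f : X → Y} (hg : LiftsThrough S g)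
    (hf : LiftsThrough Set.univ f) : LiftsThrough S (g ∘ f) := by
  intro n p hp hS v a hv
  obtain ⟨q, hq, hqv, hgq⟩ := hg n p hp hS v (f a) hv
  obtain ⟨r, hr, hrv, hfr⟩ := hf n q hq (fun _ => Set.mem_univ _) v a hqv
  refine ⟨r, hr, hrv, ?_⟩
  filter_upwards [hgq, hfr] with w h1 h2
  rw [Function.comp_apply, h2, h1]

end Germs

/-! ### Charts of diffeological spaces -/

section Charts

variable {U V W X Y : Type*}
  [NormedAddCommGroup U] [NormedSpace ℝ U] [FiniteDimensional ℝ U]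
  [DiffeologicalSpace U] [IsContDiffCompatible U]
  [NormedAddCommGroup V] [NormedSpace ℝ V] [FiniteDimensional ℝ V]
  [DiffeologicalSpace V] [IsContDiffCompatible V]
  [NormedAddCommGroup W] [NormedSpace ℝ W] [FiniteDimensional ℝ W]
  [DiffeologicalSpace W] [IsContDiffCompatible W]
  [DiffeologicalSpace X] [DiffeologicalSpace Y]

/-- `c` is a diffeomorphism of the whole vector space `V` onto an open subset of `X`, with inverse
`r`. The values of `r` outside the range of `c` are irrelevant. -/
structure IsDChart (c : V → X) (r : X → V) : Prop where
  dSmooth : DSmooth c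
  left_inv : ∀ a, r (c a) = a
  contDiffAt : ∀ (n : ℕ) (p : EuclideanSpace ℝ (Fin n) → X), IsPlot p → ∀ v, p v ∈ Set.range c →
    ContDiffAt ℝ ∞ (r ∘ p) v
  isDOpen_range : IsDOpen (Set.range c)

namespace IsDChart

variable {c : V → X} {r : X → V}

theorem injective (h : IsDChart c r) : Function.Injective c :=
  Function.LeftInverse.injective h.left_inv

theorem right_inv (h : IsDChart c r) {x : X} (hx : x ∈ Set.range c) : c (r x) = x := by
  obtain ⟨a, rfl⟩ := hx
  rw [h.left_inv]

theorem liftsThrough (h : IsDChart c r) : LiftsThrough Set.univ c := by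
  intro n p hp _ v a hv
  have hev : ∀ᶠ w in 𝓝 v, p w ∈ Set.range c :=
    h.isDOpen_range.eventually hp.dSmooth ⟨a, hv.symm⟩
  obtain ⟨q, hq, hqr⟩ := exists_contDiff_eventuallyEq (hev.mono fun w hw => h.contDiffAt n p hp w hw)
  refine ⟨q, hq.isPlot, ?_, ?_⟩
  · rw [hqr.self_of_nhds, Function.comp_apply, hv, h.left_inv]
  · filter_upwards [hev, hqr] with w h1 h2
    rw [h2, Function.comp_apply, h.right_inv h1]

theorem exists_lift (h : IsDChart c r) {p : W → X} (hp : DSmooth p) {v : W} {a : V}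
    (hv : p v = c a) :
    ∃ q : W → V, ContDiff ℝ ∞ q ∧ q v = a ∧ ∀ᶠ w in 𝓝 v, c (q w) = p w := by
  obtain ⟨q, hq, h1, h2⟩ := h.liftsThrough.exists_lift hp (by simp) hv
  exact ⟨q, hq.contDiff, h1, h2⟩

theorem comp (h : IsDChart c r) (e : OpenPartialHomeomorph U V) (hs : e.source = Set.univ)
    (he : ContDiff ℝ ∞ e) (he' : ContDiffOn ℝ ∞ e.symm e.target) :
    IsDChart (c ∘ e) (e.symm ∘ r) where
  dSmooth := h.dSmooth.comp he.dSmooth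
  left_inv a := by
    simp only [Function.comp_apply, h.left_inv]
    exact e.left_inv (by simp [hs])
  contDiffAt n p hp v hv := by
    obtain ⟨a, ha⟩ := hv
    have h1 : r (p v) = e a := by rw [← ha, Function.comp_apply, h.left_inv]
    have h2 : e a ∈ e.target := e.map_source (by simp [hs])
    rw [Function.comp_assoc]
    refine ContDiffAt.comp v ?_ (h.contDiffAt n p hp v ⟨e a, ha⟩)
    rw [Function.comp_apply, h1]
    exact he'.contDiffAt (e.open_target.mem_nhds h2)
  isDOpen_range := by
    refine isOpen_iff_preimages_plots.2 fun n p hp => isOpen_iff_mem_nhds.2 fun v hv => ?_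
    obtain ⟨a, ha⟩ := hv
    have h1 : r (p v) = e a := by rw [← ha, Function.comp_apply, h.left_inv]
    have h2 : e a ∈ e.target := e.map_source (by simp [hs])
    have h3 := (h.contDiffAt n p hp v ⟨e a, ha⟩).continuousAt.eventually_mem
      (e.open_target.mem_nhds (by rwa [Function.comp_apply, h1]))
    filter_upwards [h3, h.isDOpen_range.eventually hp.dSmooth ⟨e a, ha⟩] with w h4 h5
    exact ⟨e.symm (r (p w)), by
      rw [Function.comp_apply, e.right_inv (show r (p w) ∈ e.target from h4), h.right_inv h5]⟩

end IsDChart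

end Charts

open OpenPartialHomeomorph in
/-- Around each point, a manifold has a chart whose image is a ball; the ball is identified with
the whole Euclidean space. -/
theorem exists_isDChart_of_isManifold {X : Type*} [DiffeologicalSpace X] {d : ℕ}
    [TopologicalSpace X] [ChartedSpace (EuclideanSpace ℝ (Fin d)) X] [IsManifold (𝓡 d) ∞ X]
    (h : ∀ (n : ℕ) (p : EuclideanSpace ℝ (Fin n) → X), IsPlot p ↔ ContMDiff (𝓡 n) (𝓡 d) ∞ p)
    (x : X) :
    ∃ (c : EuclideanSpace ℝ (Fin d) → X) (r : X → EuclideanSpace ℝ (Fin d)),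
      IsDChart c r ∧ c 0 = x := by
  let φ := chartAt (EuclideanSpace ℝ (Fin d)) x
  obtain ⟨ε, hε, hεU⟩ := Metric.mem_nhds_iff.1
    (φ.open_target.mem_nhds (φ.map_source (mem_chart_source _ x)))
  let σ := univBall (φ x) ε
  have hσ : ∀ a, σ a ∈ Metric.ball (φ x) ε := fun a => by
    rw [← univBall_target (φ x) hε]
    exact σ.map_source (by simp [σ])
  have hrange : Set.range (φ.symm ∘ σ) = φ.source ∩ φ ⁻¹' Metric.ball (φ x) ε := by
    ext z
    constructor
    · rintro ⟨a, rfl⟩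
      exact ⟨φ.map_target (hεU (hσ a)), by
        simpa [φ.right_inv (hεU (hσ a))] using hσ a⟩
    · rintro ⟨hz, hz'⟩
      rw [Set.mem_preimage, ← univBall_target (φ x) hε] at hz'
      exact ⟨σ.symm (φ z), by rw [Function.comp_apply, σ.right_inv hz', φ.left_inv hz]⟩
  refine ⟨φ.symm ∘ σ, σ.symm ∘ φ, ⟨?_, ?_, ?_, ?_⟩, ?_⟩
  · refine IsPlot.dSmooth ((h _ _).2 ?_)
    exact (contMDiffOn_chart_symm (I := 𝓡 d) (n := ∞) (x := x)).comp_contMDiff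
      contDiff_univBall.contMDiff fun a => hεU (hσ a)
  · intro a
    simp only [Function.comp_apply]
    rw [φ.right_inv (hεU (hσ a))]
    exact σ.left_inv (by simp [σ])
  · intro n p hp v hv
    rw [hrange] at hv
    have h1 : ContMDiffAt (𝓡 n) (𝓡 d) ∞ (φ ∘ p) v :=
      ContMDiffAt.comp v ((contMDiffOn_chart (I := 𝓡 d) (n := ∞) (x := x)).contMDiffAt
        (φ.open_source.mem_nhds hv.1)) ((h n p).1 hp v)
    rw [Function.comp_assoc]
    refine ContDiffAt.comp v ?_ h1.contDiffAt
    exact contDiffOn_univBall_symm.contDiffAt (Metric.isOpen_ball.mem_nhds hv.2)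
  · refine isOpen_iff_preimages_plots.2 fun n p hp => ?_
    rw [hrange]
    exact (φ.isOpen_inter_preimage Metric.isOpen_ball).preimage ((h n p).1 hp).continuous
  · simp [σ, φ.left_inv (mem_chart_source _ x)]

/-! ### Infinitesimally quasi-étale maps -/

section Rigidity

variable {U V W X Y : Type*}
  [NormedAddCommGroup U] [NormedSpace ℝ U] [FiniteDimensional ℝ U]
  [DiffeologicalSpace U] [IsContDiffCompatible U]
  [NormedAddCommGroup V] [NormedSpace ℝ V] [FiniteDimensional ℝ V]
  [DiffeologicalSpace V] [IsContDiffCompatible V]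
  [NormedAddCommGroup W] [NormedSpace ℝ W] [FiniteDimensional ℝ W]
  [DiffeologicalSpace W] [IsContDiffCompatible W]
  [DiffeologicalSpace X] [DiffeologicalSpace Y]

/-- An injective derivative between spaces of the same finite dimension, as an equivalence. -/
theorem ContDiff.exists_hasFDerivAt_equiv {f : V → W} (hf : ContDiff ℝ ∞ f)
    {a : V} (hinj : Function.Injective (fderiv ℝ f a))
    (hdim : Module.finrank ℝ V = Module.finrank ℝ W) :
    ∃ e : V ≃L[ℝ] W, (e : V →L[ℝ] W) = fderiv ℝ f a ∧ HasStrictFDerivAt f (e : V →L[ℝ] W) a := by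
  let e := (LinearEquiv.ofInjectiveOfFinrankEq (fderiv ℝ f a).toLinearMap hinj
    hdim).toContinuousLinearEquiv
  have he : (e : V →L[ℝ] W) = fderiv ℝ f a := by
    ext x
    rfl
  exact ⟨e, he, he ▸ hf.contDiffAt.hasStrictFDerivAt (by simp)⟩

/-- The infinitesimal form of being quasi-étale at the point `a` of a vector space: smooth maps
into the fiber through `a` are locally constant at `a`, and a smooth self-map that fixes `a` and
preserves `φ` near `a` has invertible derivative at `a`. -/
structure IsQuasiEtaleAt (φ : V → X) (a : V) : Prop where
  eventually_const : ∀ (n : ℕ) (h : EuclideanSpace ℝ (Fin n) → V), ContDiff ℝ ∞ h →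
    ∀ v, h v = a → (∀ᶠ w in 𝓝 v, φ (h w) = φ a) → ∀ᶠ w in 𝓝 v, h w = a
  rigid : ∀ h : V → V, ContDiff ℝ ∞ h → h a = a → (∀ᶠ w in 𝓝 a, φ (h w) = φ w) →
    Function.Injective (fderiv ℝ h a)

namespace IsQuasiEtaleAt

theorem eventually_const' {φ : V → X} {a : V} (hφ : IsQuasiEtaleAt φ a) {h : W → V}
    (hh : ContDiff ℝ ∞ h) {v : W} (hv : h v = a) (hc : ∀ᶠ w in 𝓝 v, φ (h w) = φ a) :
    ∀ᶠ w in 𝓝 v, h w = a := by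
  let e := toEuclidean (E := W)
  have hlim : Filter.Tendsto e.symm (𝓝 (e v)) (𝓝 v) := by
    simpa using e.symm.continuous.tendsto (e v)
  have h1 := hφ.eventually_const _ (h ∘ e.symm) (hh.comp e.symm.contDiff) (e v) (by simpa using hv)
    (hlim.eventually hc)
  filter_upwards [e.continuous.continuousAt.eventually h1] with w hw
  simpa using hw

theorem of_comp {g : X → Y} {φ : V → X} {a : V} (h : IsQuasiEtaleAt (g ∘ φ) a) :
    IsQuasiEtaleAt φ a where
  eventually_const n k hk v hv hc :=
    h.eventually_const n k hk v hv (hc.mono fun _ hw => congrArg g hw)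
  rigid k hk ha hc := h.rigid k hk ha (hc.mono fun _ hw => congrArg g hw)

/-- Two charts of the same dimension, both of which lift the plots in a set `S` containing their
images, are quasi-étale at the same points of `S`: lifting one through the other and back gives a
self-map preserving one of them, so that both lifts are local diffeomorphisms. -/
theorem of_liftsThrough {S : Set X} {φ : V → X} {χ : W → X} {a : V} {b : W}
    (hχb : IsQuasiEtaleAt χ b) (hφ : DSmooth φ) (hχ : DSmooth χ) (hφS : ∀ v, φ v ∈ S)
    (hχS : ∀ w, χ w ∈ S) (hφl : LiftsThrough S φ) (hχl : LiftsThrough S χ) (hab : φ a = χ b)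
    (hdim : Module.finrank ℝ V = Module.finrank ℝ W) : IsQuasiEtaleAt φ a := by
  obtain ⟨A, hA, hAa, hχA⟩ := hχl.exists_lift hφ (v := a) (by simp [hφS]) hab
  obtain ⟨B, hB, hBb, hφB⟩ := hφl.exists_lift hχ (v := b) (by simp [hχS]) hab.symm
  replace hA := hA.contDiff
  replace hB := hB.contDiff
  have hBlim : Filter.Tendsto B (𝓝 b) (𝓝 a) := by
    have := hB.continuous.tendsto b
    rwa [hBb] at this
  have hdA : DifferentiableAt ℝ A a := hA.contDiffAt.differentiableAt (by simp)
  have hdB : DifferentiableAt ℝ B b := hB.contDiffAt.differentiableAt (by simp)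
  -- A self-map of `V` preserving `φ` induces a self-map of `W` preserving `χ`.
  have key : ∀ k : V → V, ContDiff ℝ ∞ k → k a = a → (∀ᶠ w in 𝓝 a, φ (k w) = φ w) →
      ∀ x, fderiv ℝ A a (fderiv ℝ k a (fderiv ℝ B b x)) = 0 → x = 0 := by
    intro k hk hka hφk x hx
    have hklim : Filter.Tendsto k (𝓝 a) (𝓝 a) := by
      have := hk.continuous.tendsto a
      rwa [hka] at this
    have hdk : DifferentiableAt ℝ k a := hk.contDiffAt.differentiableAt (by simp)
    have h1 := hχb.rigid (A ∘ k ∘ B) (hA.comp (hk.comp hB)) (by simp [hBb, hka, hAa]) (by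
      filter_upwards [hBlim.eventually (hklim.eventually hχA), hBlim.eventually hφk, hφB]
        with w h1 h2 h3
      simp only [Function.comp_apply]
      rw [h1, h2, h3])
    have h2 : HasFDerivAt (A ∘ k ∘ B)
        ((fderiv ℝ A a).comp ((fderiv ℝ k a).comp (fderiv ℝ B b))) b := by
      refine HasFDerivAt.comp b ?_ (HasFDerivAt.comp b ?_ hdB.hasFDerivAt)
      · rw [Function.comp_apply, hBb, hka]
        exact hdA.hasFDerivAt
      · rw [hBb]
        exact hdk.hasFDerivAt
    rw [h2.fderiv] at h1
    exact h1 (by simpa using hx)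
  have hid := key id contDiff_id rfl (by simp)
  simp only [fderiv_id, ContinuousLinearMap.id_apply] at hid
  have hBinj : Function.Injective (fderiv ℝ B b) :=
    (injective_iff_map_eq_zero _).2 fun x hx => hid x (by rw [hx, map_zero])
  obtain ⟨eB, heB, -⟩ := hB.exists_hasFDerivAt_equiv hBinj hdim.symm
  have hBsurj : ∀ y, ∃ x, fderiv ℝ B b x = y := fun y =>
    ⟨eB.symm y, by rw [← heB]; simp⟩
  have hAinj : Function.Injective (fderiv ℝ A a) :=
    (injective_iff_map_eq_zero _).2 fun y hy => by
      obtain ⟨x, rfl⟩ := hBsurj y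
      rw [hid x hy, map_zero]
  obtain ⟨eA, -, heA⟩ := hA.exists_hasFDerivAt_equiv hAinj hdim
  refine ⟨fun n h hh v hv hc => ?_, fun k hk hka hφk => ?_⟩
  · have hlim : Filter.Tendsto h (𝓝 v) (𝓝 a) := by
      have := hh.continuous.tendsto v
      rwa [hv] at this
    have h1 := hχb.eventually_const n (A ∘ h) (hA.comp hh) v (by simp [hv, hAa]) (by
      filter_upwards [hlim.eventually hχA, hc] with w h1 h2
      rw [Function.comp_apply, h1, h2, hab])
    filter_upwards [h1, hlim.eventually heA.eventually_left_inverse] with w h2 h3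
    have h4 := heA.eventually_left_inverse.self_of_nhds
    exact h3.symm.trans ((congrArg _ (h2.trans hAa.symm)).trans h4)
  · refine (injective_iff_map_eq_zero _).2 fun y hy => ?_
    obtain ⟨x, rfl⟩ := hBsurj y
    rw [key k hk hka hφk x (by rw [hy, map_zero]), map_zero]

/-- A map that is fibered over a map quasi-étale at `a`, and is quasi-étale along the slice over
`a`, is quasi-étale: a self-map preserving it has block triangular derivative. -/
theorem of_slice {Ψ : V × W → X} {p : X → Y} {χ : V → Y} {a : V} {b : W}
    (hχ : IsQuasiEtaleAt χ a) (hΨ : IsQuasiEtaleAt (fun w => Ψ (a, w)) b)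
    (hp : ∀ v w, p (Ψ (v, w)) = χ v) : IsQuasiEtaleAt Ψ (a, b) := by
  refine ⟨fun n h hh v hv hc => ?_, fun h hh hab hc => ?_⟩
  · have h1 := hχ.eventually_const n (fun w => (h w).1) (contDiff_fst.comp hh) v
      (by simp [hv]) (by
        filter_upwards [hc] with w hw
        rw [← hp _ (h w).2, ← hp a b]
        exact congrArg p hw)
    have h2 := hΨ.eventually_const n (fun w => (h w).2) (contDiff_snd.comp hh) v
      (by simp [hv]) (by
        filter_upwards [hc, h1] with w hw hw1
        rw [← hw]
        exact congrArg Ψ (Prod.ext hw1.symm rfl))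
    filter_upwards [h1, h2] with w h3 h4 using Prod.ext h3 h4
  · have hd : HasFDerivAt h (fderiv ℝ h (a, b)) (a, b) :=
      (hh.contDiffAt.differentiableAt (by simp)).hasFDerivAt
    have hinl : HasFDerivAt (fun v : V => (v, b)) (ContinuousLinearMap.inl ℝ V W) a :=
      hasFDerivAt_prodMk_left a b
    have hinr : HasFDerivAt (fun w : W => (a, w)) (ContinuousLinearMap.inr ℝ V W) b :=
      hasFDerivAt_prodMk_right a b
    have hsl : ∀ᶠ v in 𝓝 a, Ψ (h (v, b)) = Ψ (v, b) :=
      ((Continuous.prodMk_left b).tendsto a).eventually hc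
    have hsr : ∀ᶠ w in 𝓝 b, Ψ (h (a, w)) = Ψ (a, w) :=
      ((Continuous.prodMk_right a).tendsto b).eventually hc
    -- The first component is constant along the slice over `a`.
    have h1 : ∀ᶠ w in 𝓝 b, (h (a, w)).1 = a := by
      refine hχ.eventually_const' (h := fun w => (h (a, w)).1) (by fun_prop) (by simp [hab]) ?_
      filter_upwards [hsr] with w hw
      rw [← hp _ (h (a, w)).2, ← hp a w]
      exact congrArg p hw
    have hi1 := hχ.rigid (fun v => (h (v, b)).1) (by fun_prop) (by simp [hab]) (by
      filter_upwards [hsl] with v hv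
      rw [← hp _ (h (v, b)).2, ← hp v b]
      exact congrArg p hv)
    have hi2 := hΨ.rigid (fun w => (h (a, w)).2) (by fun_prop) (by simp [hab]) (by
      filter_upwards [hsr, h1] with w hw hw1
      rw [← hw]
      exact congrArg Ψ (Prod.ext hw1.symm rfl))
    have hd1 : HasFDerivAt (fun v => (h (v, b)).1) ((ContinuousLinearMap.fst ℝ V W).comp
        ((fderiv ℝ h (a, b)).comp (ContinuousLinearMap.inl ℝ V W))) a :=
      hasFDerivAt_fst.comp a (hd.comp a hinl)
    have hd2 : HasFDerivAt (fun w => (h (a, w)).2) ((ContinuousLinearMap.snd ℝ V W).comp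
        ((fderiv ℝ h (a, b)).comp (ContinuousLinearMap.inr ℝ V W))) b :=
      hasFDerivAt_snd.comp b (hd.comp b hinr)
    have hd3 : HasFDerivAt (fun w => (h (a, w)).1) ((ContinuousLinearMap.fst ℝ V W).comp
        ((fderiv ℝ h (a, b)).comp (ContinuousLinearMap.inr ℝ V W))) b :=
      hasFDerivAt_fst.comp b (hd.comp b hinr)
    have hz := hd3.unique ((hasFDerivAt_const a b).congr_of_eventuallyEq h1)
    rw [hd1.fderiv] at hi1
    rw [hd2.fderiv] at hi2
    refine (injective_iff_map_eq_zero _).2 fun ⟨x, y⟩ hxy => ?_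
    have hsplit : ((x, y) : V × W) = (x, 0) + (0, y) := by simp
    have hzy : (fderiv ℝ h (a, b) (0, y)).1 = 0 := by
      simpa using congrArg (fun L => L y) hz
    have hx : x = 0 := by
      refine (injective_iff_map_eq_zero _).1 hi1 x ?_
      rw [hsplit, map_add] at hxy
      have := congrArg Prod.fst hxy
      simpa [hzy] using this
    subst hx
    have hy : y = 0 := by
      refine (injective_iff_map_eq_zero _).1 hi2 y ?_
      simpa using congrArg Prod.snd hxy
    rw [hy]
    rfl

end IsQuasiEtaleAt

end Rigidity

/-! ### Quasi-étale maps in charts -/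

section QuasiEtale

variable {V W N X : Type*}
  [NormedAddCommGroup V] [NormedSpace ℝ V] [FiniteDimensional ℝ V]
  [DiffeologicalSpace V] [IsContDiffCompatible V]
  [NormedAddCommGroup W] [NormedSpace ℝ W] [FiniteDimensional ℝ W]
  [DiffeologicalSpace W] [IsContDiffCompatible W]
  [DiffeologicalSpace N] [DiffeologicalSpace X]

/-- The inverse function theorem, with a smooth inverse on a neighbourhood on which a prescribed
local property holds. -/
theorem ContDiff.exists_openPartialHomeomorph {f : V → W} (hf : ContDiff ℝ ∞ f) {a : V}
    (hinj : Function.Injective (fderiv ℝ f a))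
    (hdim : Module.finrank ℝ V = Module.finrank ℝ W) {P : V → Prop} (hP : ∀ᶠ v in 𝓝 a, P v) :
    ∃ e : OpenPartialHomeomorph V W, a ∈ e.source ∧ (∀ v, e v = f v) ∧ (∀ v ∈ e.source, P v) ∧
      ContDiffOn ℝ ∞ e.symm e.target := by
  obtain ⟨L, hL, hLf⟩ := hf.exists_hasFDerivAt_equiv hinj hdim
  have hev : ∀ᶠ v in 𝓝 a, P v ∧ fderiv ℝ f v ∈ Set.range ((↑) : (V ≃L[ℝ] W) → V →L[ℝ] W) := by
    refine hP.and ?_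
    have hcont : Continuous (fderiv ℝ f) := hf.continuous_fderiv (by simp)
    exact hcont.continuousAt.eventually_mem (ContinuousLinearEquiv.isOpen.mem_nhds ⟨L, hL⟩)
  obtain ⟨s, hs, hso, has⟩ := eventually_nhds_iff.1 hev
  let e₀ := hLf.toOpenPartialHomeomorph f
  refine ⟨e₀.restrOpen s hso, ⟨hLf.mem_toOpenPartialHomeomorph_source, has⟩, fun v => rfl,
    fun v hv => (hs v hv.2).1, fun w hw => ContDiffAt.contDiffWithinAt ?_⟩
  obtain ⟨L', hL'⟩ := (hs _ ((e₀.restrOpen s hso).map_target hw).2).2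
  refine (e₀.restrOpen s hso).contDiffAt_symm (f₀' := L') hw ?_ hf.contDiffAt
  rw [hL']
  exact (hf.contDiffAt.differentiableAt (by simp)).hasFDerivAt

theorem IsDChart.isDOpen_image {c : V → X} {r : X → V} (h : IsDChart c r) {s : Set V}
    (hs : IsOpen s) : IsDOpen (c '' s) := by
  refine isOpen_iff_preimages_plots.2 fun n p hp => isOpen_iff_mem_nhds.2 fun v hv => ?_
  obtain ⟨a, ha, hav⟩ := hv
  have h1 := (h.contDiffAt n p hp v ⟨a, hav⟩).continuousAt.eventually_mem
    (hs.mem_nhds (by rwa [Function.comp_apply, ← hav, h.left_inv]))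
  filter_upwards [h1, h.isDOpen_range.eventually hp.dSmooth ⟨a, hav⟩] with w h2 h3
  exact ⟨_, h2, h.right_inv h3⟩

theorem IsDChart.contDiff_comp {c : V → X} {r : X → V} (h : IsDChart c r) {n : ℕ}
    {p : EuclideanSpace ℝ (Fin n) → X} (hp : IsPlot p) (hpc : ∀ w, p w ∈ Set.range c) :
    ContDiff ℝ ∞ (r ∘ p) :=
  contDiff_iff_contDiffAt.2 fun v => h.contDiffAt n p hp v (hpc v)

/-- A local subduction from a manifold is quasi-étale as soon as it is so infinitesimally in
charts. -/
theorem IsLocalSubduction.isQuasiEtale {π : N → X} (hπ : IsLocalSubduction π)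
    (hN : ∀ x : N, ∃ (c : V → N) (r : N → V) (a : V), IsDChart c r ∧ c a = x)
    (hq : ∀ (c : V → N) (r : N → V), IsDChart c r → ∀ a, IsQuasiEtaleAt (π ∘ c) a) :
    IsQuasiEtale π := by
  refine ⟨hπ, fun y n p hp => ?_, fun O hO f hf hfπ x => ?_⟩
  · refine (IsLocallyConstant.iff_eventually_eq _).2 fun v => ?_
    obtain ⟨c, r, a, hc, hca⟩ := hN (p v)
    obtain ⟨q, hq', hqv, hqp⟩ := hc.exists_lift (p := fun w => (p w).1)
      (dSmooth_subtypeVal.comp hp.dSmooth) hca.symm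
    have h1 := (hq c r hc a).eventually_const n q hq' v hqv (by
      filter_upwards [hqp] with w hw
      rw [Function.comp_apply, hw, Function.comp_apply, hca]
      exact (p w).2.trans (p v).2.symm)
    filter_upwards [hqp, h1] with w h2 h3
    exact Subtype.ext (by rw [← h2, h3, hca])
  · obtain ⟨c, r, a, hc, hca⟩ := hN x.1
    obtain ⟨c', r', a', hc', hca'⟩ := hN (f x)
    have hcO : ∀ᶠ v in 𝓝 a, c v ∈ O := hO.eventually hc.dSmooth (by rw [hca]; exact x.2)
    obtain ⟨ρ, hρ, hρO, hρa⟩ := exists_smooth_retraction_near a hcO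
    have hxa : (⟨c (ρ a), hρO a⟩ : O) = x :=
      Subtype.ext ((congrArg c hρa.self_of_nhds).trans hca)
    obtain ⟨h, hh, hha, hhf⟩ := hc'.exists_lift (p := fun v => f ⟨c (ρ v), hρO v⟩) (v := a)
      (hf.comp (dSmooth_subtype_iff.2 (hc.dSmooth.comp hρ.dSmooth)))
      ((congrArg f hxa).trans hca'.symm)
    have hhf' : ∀ᶠ v in 𝓝 a, ∃ hv : c v ∈ O, c' (h v) = f ⟨c v, hv⟩ := by
      filter_upwards [hhf, hρa, hcO] with v h1 h2 h3
      exact ⟨h3, h1.trans (congrArg f (Subtype.ext (congrArg c h2)))⟩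
    -- The coordinate expression of `f` followed by a lift back is a self-map preserving `π`.
    obtain ⟨k, hk, hka, hkπ⟩ := (hπ.liftsThrough.comp hc.liftsThrough).exists_lift
      (p := π ∘ c') (v := a') (hπ.1.comp hc'.dSmooth) (by simp) (a := a) (by
        simp only [Function.comp_apply, hca', hca, hfπ])
    replace hk := hk.contDiff
    have hinj : Function.Injective (fderiv ℝ h a) := by
      have h1 := (hq c r hc a).rigid (k ∘ h) (hk.comp hh) (by simp [hha, hka]) (by
        have hlim : Filter.Tendsto h (𝓝 a) (𝓝 a') := by
          have := hh.continuous.tendsto a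
          rwa [hha] at this
        filter_upwards [hlim.eventually hkπ, hhf'] with v h1 ⟨h2, h3⟩
        exact h1.trans ((congrArg π h3).trans (hfπ _)))
      rw [fderiv_comp a (by rw [hha]; exact hk.contDiffAt.differentiableAt (by simp))
        (hh.contDiffAt.differentiableAt (by simp))] at h1
      exact Function.Injective.of_comp (f := fderiv ℝ k (h a)) h1
    obtain ⟨e, hae, heh, heP, hes⟩ := hh.exists_openPartialHomeomorph hinj rfl hhf'
    have hVO : ∀ v ∈ e.source, c v ∈ O := fun v hv => (heP v hv).1
    have hfc : ∀ v (hv : v ∈ e.source), f ⟨c v, hVO v hv⟩ = c' (e v) := fun v hv => by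
      rw [heh]
      exact (heP v hv).2.symm
    have hmaps : Set.MapsTo f (Subtype.val ⁻¹' (c '' e.source)) (c' '' e.target) := by
      rintro ⟨_, ho⟩ ⟨v, hv, rfl⟩
      exact ⟨e v, e.map_source hv, (hfc v hv).symm⟩
    have hback : ∀ w : c' '' e.target, r' w.1 ∈ e.target := by
      rintro ⟨_, w, hw, rfl⟩
      rwa [hc'.left_inv]
    refine ⟨Subtype.val ⁻¹' (c '' e.source), c' '' e.target,
      (hc.isDOpen_image e.open_source).preimage dSmooth_subtypeVal,
      hc'.isDOpen_image e.open_target, ⟨a, hae, hca⟩, hmaps,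
      dSmooth_subtype_iff.2 (hf.comp dSmooth_subtypeVal),
      fun w => ⟨⟨c (e.symm (r' w.1)), hVO _ (e.map_target (hback w))⟩,
        ⟨_, e.map_target (hback w), rfl⟩⟩, ?_, ?_, ?_⟩
    · intro n p hp
      have h1 : ContDiff ℝ ∞ (r' ∘ fun w => (p w).1) := hc'.contDiff_comp hp fun w =>
        Set.image_subset_range _ _ (p w).2
      have h2 : ContDiff ℝ ∞ (e.symm ∘ r' ∘ fun w => (p w).1) :=
        hes.comp_contDiff h1 fun w => hback (p w)
      exact hc.dSmooth _ _ h2.isPlot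
    · intro o
      obtain ⟨v, hv, hvo⟩ := o.2
      have hfo : f o.1 = c' (e v) := (congrArg f (Subtype.ext hvo.symm)).trans (hfc v hv)
      refine Subtype.ext (Subtype.ext ?_)
      simp only [Set.MapsTo.val_restrict_apply]
      rw [hfo, hc'.left_inv, e.left_inv hv, hvo]
    · rintro ⟨_, w, hw, rfl⟩
      refine Subtype.ext ?_
      simp only [Set.MapsTo.val_restrict_apply]
      rw [hfc _ (e.map_target (hback ⟨_, w, hw, rfl⟩)), e.right_inv (hback ⟨_, w, hw, rfl⟩),
        hc'.left_inv]

theorem IsQuasiEtale.isQuasiEtaleAt {π : N → X} (hπ : IsQuasiEtale π) {c : V → N} {r : N → V}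
    (hc : IsDChart c r) (a : V) : IsQuasiEtaleAt (π ∘ c) a := by
  refine ⟨fun n h hh v hv hcst => ?_, fun h hh ha hpres => ?_⟩
  · obtain ⟨ρ, hρ, hρf, hρv⟩ := exists_smooth_retraction_near v hcst
    have h1 := hπ.totallyDisconnected_fibers (π (c a)) n (fun w => ⟨c (h (ρ w)), hρf w⟩)
      (hc.dSmooth.comp (hh.comp hρ).dSmooth).isPlot
    filter_upwards [(IsLocallyConstant.iff_eventually_eq _).1 h1 v, hρv] with w h2 h3
    have h4 := congrArg Subtype.val h2
    simp only [h3, hρv.self_of_nhds, hv] at h4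
    exact hc.injective h4
  · obtain ⟨s, hs, hso, has⟩ := eventually_nhds_iff.1 hpres
    have hr : ∀ o : c '' s, r o.1 ∈ s ∧ c (r o.1) = o.1 := by
      rintro ⟨_, v, hv, rfl⟩
      exact ⟨by rwa [hc.left_inv], by rw [hc.left_inv]⟩
    obtain ⟨A, B, hA, hB, hxA, hmaps, -, g, hg, hgl, -⟩ := hπ.rigid (c '' s)
      (hc.isDOpen_image hso) (fun o => c (h (r o.1))) (fun n p hp => by
        have h1 : ContDiff ℝ ∞ (r ∘ fun w => (p w).1) := hc.contDiff_comp hp fun w =>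
          Set.image_subset_range _ _ (p w).2
        exact hc.dSmooth _ _ (hh.comp h1).isPlot)
      (fun o => by
        have := hs _ (hr o).1
        simpa only [Function.comp_apply, (hr o).2] using this) ⟨c a, a, has, rfl⟩
    have hcaB : c a ∈ B := by
      have := hmaps hxA
      simpa only [hc.left_inv, ha] using this
    obtain ⟨ρ, hρ, hρB, hρa⟩ := exists_smooth_retraction_near a (hB.eventually hc.dSmooth hcaB)
    let K : V → N := fun v => (g ⟨c (ρ v), hρB v⟩).1.1
    have hK : DSmooth K := (dSmooth_subtypeVal.comp dSmooth_subtypeVal).comp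
      (hg.comp (dSmooth_subtype_iff.2 (hc.dSmooth.comp hρ.dSmooth)))
    have hlim : Filter.Tendsto h (𝓝 a) (𝓝 a) := by
      have := hh.continuous.tendsto a
      rwa [ha] at this
    have hKh : ∀ᶠ v in 𝓝 a, K (h v) = c v := by
      obtain ⟨ρ', hρ', hρs', hρa'⟩ := exists_smooth_retraction_near a (hso.mem_nhds has)
      have hev := hA.eventually (f := fun v => (⟨c (ρ' v), ρ' v, hρs' v, rfl⟩ : c '' s))
        (dSmooth_subtype_iff.2 (hc.dSmooth.comp hρ'.dSmooth)) (v := a) (by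
          simpa only [hρa'.self_of_nhds] using hxA)
      filter_upwards [hev, hlim.eventually hρa, hρa'] with v h1 h2 h3
      have h4 := congrArg (fun z => z.1.1) (hgl ⟨_, h1⟩)
      simp only [h3] at h4
      rw [← h4]
      refine congrArg (fun z => (g z).1.1) (Subtype.ext ?_)
      simp only [h2, Set.MapsTo.val_restrict_apply, hc.left_inv]
    obtain ⟨k, hk, hka, hkK⟩ := hc.exists_lift hK (v := a) (a := a) (by
      have := hKh.self_of_nhds
      rwa [ha] at this)
    have hkh : ∀ᶠ v in 𝓝 a, (k ∘ h) v = v := by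
      filter_upwards [hlim.eventually hkK, hKh] with v h1 h2
      exact hc.injective (h1.trans h2)
    have h1 : fderiv ℝ (k ∘ h) a = ContinuousLinearMap.id ℝ V :=
      ((hasFDerivAt_id a).congr_of_eventuallyEq hkh).fderiv
    rw [fderiv_comp a (hk.contDiffAt.differentiableAt (by simp))
      (hh.contDiffAt.differentiableAt (by simp))] at h1
    refine Function.LeftInverse.injective (g := fderiv ℝ k (h a)) fun x => ?_
    exact congrArg (fun L => L x) h1

end QuasiEtale

/-! ### Normal form of a submersion with a section -/

section NormalForm

open OpenPartialHomeomorph in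
/-- Normal form of a retraction `s : N → M` of manifolds with section `u`, near a point of the
section: there are charts, that of `N` contained in a prescribed neighbourhood `O`, in which `s` is a
linear projection and `u` its zero section. -/
theorem exists_isDChart_of_section {M N : Type*} [DiffeologicalSpace M] [DiffeologicalSpace N]
    {m d : ℕ} {s : N → M} {u : M → N} (hs : DSmooth s) (hu : DSmooth u) (hsu : ∀ x, s (u x) = x)
    {c₀ : EuclideanSpace ℝ (Fin m) → M} {r₀ : M → EuclideanSpace ℝ (Fin m)} (hc₀ : IsDChart c₀ r₀)
    {C : EuclideanSpace ℝ (Fin d) → N} {R : N → EuclideanSpace ℝ (Fin d)} (hC : IsDChart C R)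
    (h0 : C 0 = u (c₀ 0)) {O : Set N} (hO : IsDOpen O) (h0O : C 0 ∈ O) :
    m ≤ d ∧ ∃ (c : EuclideanSpace ℝ (Fin m) → M) (r : M → EuclideanSpace ℝ (Fin m))
      (ψ : EuclideanSpace ℝ (Fin m) × EuclideanSpace ℝ (Fin (d - m)) → N)
      (ρ : N → EuclideanSpace ℝ (Fin m) × EuclideanSpace ℝ (Fin (d - m))),
      IsDChart c r ∧ IsDChart ψ ρ ∧ c 0 = c₀ 0 ∧ (∀ v b, s (ψ (v, b)) = c v) ∧
        (∀ v, ψ (v, 0) = u (c v)) ∧ ∀ x, ψ x ∈ O := by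
  obtain ⟨w, hw, hw0, hCw⟩ := hC.exists_lift (hu.comp hc₀.dSmooth) (v := 0) (a := 0) h0.symm
  obtain ⟨S, hS, hS0, hcS⟩ := hc₀.exists_lift (hs.comp hC.dSmooth) (v := 0) (a := 0)
    (by rw [Function.comp_apply, h0, hsu])
  have hwlim : Filter.Tendsto w (𝓝 0) (𝓝 0) := by
    have := hw.continuous.tendsto 0
    rwa [hw0] at this
  have hSw : ∀ᶠ v in 𝓝 0, (S ∘ w) v = v := by
    filter_upwards [hwlim.eventually hcS, hCw] with v h1 h2
    refine hc₀.injective ?_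
    rw [Function.comp_apply, h1, Function.comp_apply, h2, Function.comp_apply, hsu]
  let A := fderiv ℝ S 0
  let B := fderiv ℝ w 0
  have hA : HasFDerivAt S A 0 := (hS.contDiffAt.differentiableAt (by simp)).hasFDerivAt
  have hB : HasFDerivAt w B 0 := (hw.contDiffAt.differentiableAt (by simp)).hasFDerivAt
  have hAB : ∀ x, A (B x) = x := fun x => by
    have h1 : HasFDerivAt (S ∘ w) (A.comp B) 0 := by
      refine HasFDerivAt.comp 0 ?_ hB
      rwa [hw0]
    have h2 := h1.unique ((hasFDerivAt_id (0 : EuclideanSpace ℝ (Fin m))).congr_of_eventuallyEq hSw)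
    exact congrArg (fun L => L x) h2
  have hrank := LinearMap.finrank_range_add_finrank_ker A.toLinearMap
  have hrange : LinearMap.range A.toLinearMap = ⊤ :=
    LinearMap.range_eq_top.2 fun x => ⟨B x, hAB x⟩
  rw [hrange, finrank_top, finrank_euclideanSpace_fin, finrank_euclideanSpace_fin] at hrank
  have hmd : m ≤ d := by omega
  refine ⟨hmd, ?_⟩
  -- The projection onto the kernel of the derivative of `s` along the section.
  let κ : LinearMap.ker A.toLinearMap ≃L[ℝ] EuclideanSpace ℝ (Fin (d - m)) :=
    ContinuousLinearEquiv.ofFinrankEq (by rw [finrank_euclideanSpace_fin]; omega)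
  let Q : EuclideanSpace ℝ (Fin d) →L[ℝ] LinearMap.ker A.toLinearMap :=
    (ContinuousLinearMap.id ℝ _ - B.comp A).codRestrict _ fun x => by
      simp [hAB]
  let P : EuclideanSpace ℝ (Fin d) →L[ℝ] EuclideanSpace ℝ (Fin (d - m)) :=
    (κ : _ →L[ℝ] _).comp Q
  have hP : ∀ x, A x = 0 → P x = 0 → x = 0 := by
    intro x hx hPx
    have h1 : Q x = 0 := κ.injective (by rw [map_zero]; exact hPx)
    have h2 := congrArg Subtype.val h1
    simpa [Q, hx] using h2
  let Ξ : EuclideanSpace ℝ (Fin d) →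
      EuclideanSpace ℝ (Fin m) × EuclideanSpace ℝ (Fin (d - m)) := fun x => (S x, P (x - w (S x)))
  have hΞ : ContDiff ℝ ∞ Ξ :=
    hS.prodMk (P.contDiff.comp (contDiff_id.sub (hw.comp hS)))
  have hΞ0 : Ξ 0 = 0 := by simp [Ξ, hS0, hw0]
  have hdΞ : HasFDerivAt Ξ (A.prod (P.comp (ContinuousLinearMap.id ℝ _ - B.comp A))) 0 := by
    refine hA.prodMk (P.hasFDerivAt.comp 0 ((hasFDerivAt_id 0).sub ?_))
    refine HasFDerivAt.comp 0 ?_ hA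
    rwa [hS0]
  have hinj : Function.Injective (fderiv ℝ Ξ 0) := by
    rw [hdΞ.fderiv]
    refine (injective_iff_map_eq_zero _).2 fun x hx => ?_
    have h1 : A x = 0 := congrArg Prod.fst hx
    refine hP x h1 ?_
    simpa [h1] using congrArg Prod.snd hx
  obtain ⟨e, he0, hee, heP, hes⟩ := hΞ.exists_openPartialHomeomorph hinj (by simp; omega)
    (hcS.and (hO.eventually hC.dSmooth h0O))
  have htarget : e.target ∈ 𝓝 ((0 : EuclideanSpace ℝ (Fin m)),
      (0 : EuclideanSpace ℝ (Fin (d - m)))) := by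
    have h1 := e.open_target.mem_nhds (e.map_source he0)
    rwa [hee, hΞ0] at h1
  have hsec : ∀ᶠ v in 𝓝 0, w v ∈ e.source ∧ S (w v) = v ∧ C (w v) = u (c₀ v) :=
    (hwlim.eventually_mem (e.open_source.mem_nhds he0)).and (hSw.and hCw)
  obtain ⟨ε₁, hε₁, hball₁⟩ := Metric.mem_nhds_iff.1 htarget
  obtain ⟨ε₂, hε₂, hball₂⟩ := Metric.mem_nhds_iff.1 hsec
  have hε : 0 < min ε₁ ε₂ := lt_min hε₁ hε₂
  let σ₁ := univBall (0 : EuclideanSpace ℝ (Fin m)) (min ε₁ ε₂)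
  let σ₂ := univBall (0 : EuclideanSpace ℝ (Fin (d - m))) (min ε₁ ε₂)
  have hσ₁ : ∀ v, σ₁ v ∈ Metric.ball 0 (min ε₁ ε₂) := fun v => by
    rw [← univBall_target _ hε]
    exact σ₁.map_source (by simp [σ₁])
  have hσ₂ : ∀ v, σ₂ v ∈ Metric.ball 0 (min ε₁ ε₂) := fun v => by
    rw [← univBall_target _ hε]
    exact σ₂.map_source (by simp [σ₂])
  have hσ : ∀ v b, (σ₁ v, σ₂ b) ∈ e.target := fun v b => hball₁ <| by
    rw [← ball_prod_same]
    exact ⟨Metric.ball_subset_ball (min_le_left _ _) (hσ₁ v),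
      Metric.ball_subset_ball (min_le_left _ _) (hσ₂ b)⟩
  let τ := (σ₁.prod σ₂).trans e.symm
  have hτs : τ.source = Set.univ := by
    refine Set.eq_univ_of_forall fun x => ?_
    simp only [τ, trans_source, prod_source, Set.mem_inter_iff, Set.mem_preimage]
    exact ⟨by simp [σ₁, σ₂], hσ x.1 x.2⟩
  have hσc : ContDiff ℝ ∞ (fun x : EuclideanSpace ℝ (Fin m) × EuclideanSpace ℝ (Fin (d - m)) =>
      (σ₁ x.1, σ₂ x.2)) :=
    (contDiff_univBall.comp contDiff_fst).prodMk (contDiff_univBall.comp contDiff_snd)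
  have hτ : ContDiff ℝ ∞ τ := hes.comp_contDiff hσc fun x => hσ x.1 x.2
  have hτ' : ContDiffOn ℝ ∞ τ.symm τ.target := by
    refine ContDiffOn.comp (t := Metric.ball 0 (min ε₁ ε₂) ×ˢ Metric.ball 0 (min ε₁ ε₂))
      (g := fun x => (σ₁.symm x.1, σ₂.symm x.2)) (f := Ξ) ?_ hΞ.contDiffOn ?_ |>.congr ?_
    · exact (contDiffOn_univBall_symm.comp contDiff_fst.contDiffOn fun x hx => hx.1).prodMk
        (contDiffOn_univBall_symm.comp contDiff_snd.contDiffOn fun x hx => hx.2)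
    · intro x hx
      have h1 : e x ∈ σ₁.target ×ˢ σ₂.target := by simpa [τ] using hx.2
      rwa [univBall_target _ hε, univBall_target _ hε, hee] at h1
    · intro x _
      rw [Function.comp_apply, ← hee]
      rfl
  refine ⟨c₀ ∘ σ₁, _, C ∘ τ, _, hc₀.comp σ₁ (by simp [σ₁]) contDiff_univBall ?_,
    hC.comp τ hτs hτ hτ', by simp [σ₁], fun v b => ?_, fun v => ?_,
    fun x => (heP _ (e.map_target (hσ x.1 x.2))).2⟩
  · rw [univBall_target _ hε]
    exact contDiffOn_univBall_symm
  · have h1 : τ (v, b) = e.symm (σ₁ v, σ₂ b) := rfl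
    have h2 := congrArg Prod.fst (e.right_inv (hσ v b))
    rw [hee] at h2
    have h3 := (heP _ (e.map_target (hσ v b))).1
    simp only [Function.comp_apply] at h3 ⊢
    rw [h1, ← h3]
    exact congrArg c₀ h2
  · have h1 : τ (v, 0) = e.symm (σ₁ v, σ₂ 0) := rfl
    obtain ⟨h2, h3, h4⟩ := hball₂ (Metric.ball_subset_ball (min_le_right _ _) (hσ₁ v))
    have h5 : e (w (σ₁ v)) = (σ₁ v, σ₂ 0) := by
      rw [hee]
      simp [Ξ, h3, σ₂]
    simp only [Function.comp_apply]
    rw [h1, ← h5, e.left_inv h2, h4]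

end NormalForm

/-! ### Products and inverses in local groupoids -/

/-- A smooth map that sends a segment into a totally disconnected set takes the same value at the
two ends of the segment. -/
theorem IsDTotallyDisconnected.eq_of_segment {V X : Type*}
    [NormedAddCommGroup V] [NormedSpace ℝ V] [FiniteDimensional ℝ V]
    [DiffeologicalSpace V] [IsContDiffCompatible V] [DiffeologicalSpace X] {s : Set X}
    (hs : IsDTotallyDisconnected s) {f : V → X} (hf : DSmooth f) {a b : V}
    (h : ∀ x ∈ segment ℝ a b, f x ∈ s) : f a = f b := by
  -- A smooth parametrization of the segment by the whole line.
  let γ : EuclideanSpace ℝ (Fin 1) → V := fun w => a + Real.smoothTransition (w 0) • (b - a)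
  have hγ : ContDiff ℝ ∞ γ := by
    refine contDiff_const.add (ContDiff.smul ?_ contDiff_const)
    exact Real.smoothTransition.contDiff.comp (by fun_prop)
  have hγs : ∀ w, f (γ w) ∈ s := fun w => h _ (by
    rw [segment_eq_image']
    exact ⟨_, ⟨Real.smoothTransition.nonneg _, Real.smoothTransition.le_one _⟩, rfl⟩)
  have h1 := hs 1 (fun w => ⟨f (γ w), hγs w⟩) (hf.comp hγ.dSmooth).isPlot
  have h2 := congrArg Subtype.val (h1.apply_eq_of_preconnectedSpace 0
    (EuclideanSpace.single 0 1))
  simpa [γ] using h2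

namespace LocalDiffeologicalGroupoid

section Products

variable {G X : Type*} [DiffeologicalSpace G] [DiffeologicalSpace X]
  (𝒢 : LocalDiffeologicalGroupoid G X)

/-- The product `g h` is defined and equal to `k`. -/
def IsProd (g h k : G) : Prop :=
  ∃ (e : 𝒢.src g = 𝒢.tgt h) (m : (⟨(g, h), e⟩ : FiberProd 𝒢.src 𝒢.tgt) ∈ 𝒢.mulDom),
    𝒢.mul ⟨⟨(g, h), e⟩, m⟩ = k

variable {𝒢} {g h k l a b : G}

theorem IsProd.unique (h₁ : 𝒢.IsProd g h k) (h₂ : 𝒢.IsProd g h l) : k = l := by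
  obtain ⟨_, _, rfl⟩ := h₁
  obtain ⟨_, _, rfl⟩ := h₂
  rfl

theorem IsProd.src_eq_tgt (H : 𝒢.IsProd g h k) : 𝒢.src g = 𝒢.tgt h := H.1

theorem IsProd.src_eq (H : 𝒢.IsProd g h k) : 𝒢.src k = 𝒢.src h := by
  obtain ⟨_, _, rfl⟩ := H
  exact 𝒢.src_mul _

theorem IsProd.tgt_eq (H : 𝒢.IsProd g h k) : 𝒢.tgt k = 𝒢.tgt g := by
  obtain ⟨_, _, rfl⟩ := H
  exact 𝒢.tgt_mul _

theorem IsProd.eq_of_unit_left {x : X} (H : 𝒢.IsProd (𝒢.unit x) h k) : k = h := by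
  obtain ⟨e, m, rfl⟩ := H
  obtain rfl : x = 𝒢.tgt h := by rw [← e, 𝒢.src_unit]
  exact 𝒢.unit_mul h e m

theorem IsProd.eq_of_unit_right {x : X} (H : 𝒢.IsProd g (𝒢.unit x) k) : k = g := by
  obtain ⟨e, m, rfl⟩ := H
  obtain rfl : x = 𝒢.src g := by rw [e, 𝒢.tgt_unit]
  exact 𝒢.mul_unit g e m

theorem IsProd.assoc {c c' : G} (hgh : 𝒢.IsProd g h a) (hhk : 𝒢.IsProd h k b)
    (hc : 𝒢.IsProd g b c) (hc' : 𝒢.IsProd a k c') : c = c' := by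
  obtain ⟨e₁, m₁, rfl⟩ := hgh
  obtain ⟨e₂, m₂, rfl⟩ := hhk
  obtain ⟨e₃, m₃, rfl⟩ := hc
  obtain ⟨e₄, m₄, rfl⟩ := hc'
  exact 𝒢.assoc g h k e₁ m₁ e₂ m₂ e₃ m₃ e₄ m₄

/-- Near a unit, composable smooth families of arrows have a smooth family of products. -/
theorem exists_isProd {V : Type*} [NormedAddCommGroup V] [NormedSpace ℝ V]
    [FiniteDimensional ℝ V] [DiffeologicalSpace V] [IsContDiffCompatible V] {f₁ f₂ : V → G}
    (hf₁ : DSmooth f₁) (hf₂ : DSmooth f₂) {v : V} {x : X} (hv₁ : f₁ v = 𝒢.unit x)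
    (hv₂ : f₂ v = 𝒢.unit x) (hf : ∀ᶠ w in 𝓝 v, 𝒢.src (f₁ w) = 𝒢.tgt (f₂ w)) :
    ∃ f : V → G, DSmooth f ∧ f v = 𝒢.unit x ∧ ∀ᶠ w in 𝓝 v, 𝒢.IsProd (f₁ w) (f₂ w) (f w) := by
  obtain ⟨ρ, hρ, hρf, hρv⟩ := exists_smooth_retraction_near v hf
  let F : V → FiberProd 𝒢.src 𝒢.tgt := fun w => ⟨(f₁ (ρ w), f₂ (ρ w)), hρf w⟩
  have hF : DSmooth F := dSmooth_subtype_iff.2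
    (DSmooth.prodMk (hf₁.comp hρ.dSmooth) (hf₂.comp hρ.dSmooth))
  have hFv : F v ∈ 𝒢.mulDom := by
    have h1 : F v = ⟨(𝒢.unit x, 𝒢.unit x), by rw [𝒢.src_unit, 𝒢.tgt_unit]⟩ := by
      refine Subtype.ext (Prod.ext ?_ ?_)
      · simp only [F, hρv.self_of_nhds, hv₁]
      · simp only [F, hρv.self_of_nhds, hv₂]
    rw [h1]
    exact 𝒢.unit_mem_mulDom x x _
  obtain ⟨τ, hτ, hτF, hτv⟩ := exists_smooth_retraction_near v
    (𝒢.isDOpen_mulDom.eventually hF hFv)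
  have hprod : ∀ᶠ w in 𝓝 v, 𝒢.IsProd (f₁ w) (f₂ w) (𝒢.mul ⟨F (τ w), hτF w⟩) := by
    filter_upwards [hρv, hτv] with w h1 h2
    have h3 : 𝒢.IsProd (f₁ (ρ (τ w))) (f₂ (ρ (τ w))) (𝒢.mul ⟨F (τ w), hτF w⟩) :=
      ⟨_, hτF w, rfl⟩
    simpa only [h2, h1] using h3
  refine ⟨fun w => 𝒢.mul ⟨F (τ w), hτF w⟩,
    𝒢.smooth_mul.comp (dSmooth_subtype_iff.2 (hF.comp hτ.dSmooth)), ?_, hprod⟩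
  have h1 := hprod.self_of_nhds
  rw [hv₁, hv₂] at h1
  exact h1.eq_of_unit_left

end Products

section SourceCharts

variable {V W G M : Type*}
  [NormedAddCommGroup V] [NormedSpace ℝ V] [FiniteDimensional ℝ V]
  [DiffeologicalSpace V] [IsContDiffCompatible V]
  [NormedAddCommGroup W] [NormedSpace ℝ W] [FiniteDimensional ℝ W]
  [DiffeologicalSpace W] [IsContDiffCompatible W]
  [DiffeologicalSpace G] [DiffeologicalSpace M]

/-- Charts `c` of the objects and `ψ` of the arrows of a local groupoid in which the source map is
the first projection and the unit map is the zero section. -/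
structure IsSourceChart (𝒢 : LocalDiffeologicalGroupoid G M) (c : V → M) (r : M → V)
    (ψ : V × W → G) (ρ : G → V × W) : Prop where
  chart_objects : IsDChart c r
  chart_arrows : IsDChart ψ ρ
  src_eq : ∀ v w, 𝒢.src (ψ (v, w)) = c v
  unit_eq : ∀ v, ψ (v, 0) = 𝒢.unit (c v)

variable {𝒢 : LocalDiffeologicalGroupoid G M} {c : V → M} {r : M → V}
  {ψ : V × W → G} {ρ : G → V × W}

/-- Arrows near a unit have left inverses depending smoothly on them. They are produced by the
inverse function theorem from the multiplication: the laws for the given inversion of a local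
groupoid do not suffice, since they only hold where the products involved are defined. -/
theorem IsSourceChart.exists_left_inverse (h : 𝒢.IsSourceChart c r ψ ρ) :
    ∃ I : V × W → V × W, ContDiff ℝ ∞ I ∧ I 0 = 0 ∧
      ∀ᶠ x in 𝓝 0, 𝒢.IsProd (ψ (I x)) (ψ x) (𝒢.unit (c x.1)) := by
  have hψ0 : ψ 0 = 𝒢.unit (c 0) := h.unit_eq 0
  obtain ⟨T, hT, hT0, hcT⟩ := h.chart_objects.exists_lift
    (𝒢.smooth_tgt.comp h.chart_arrows.dSmooth) (v := 0) (a := 0)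
    (by rw [Function.comp_apply, hψ0, 𝒢.tgt_unit])
  have hsnd : Filter.Tendsto (Prod.snd : W × (V × W) → V × W) (𝓝 0) (𝓝 0) :=
    continuous_snd.tendsto 0
  obtain ⟨k, hk, hk0, hkm⟩ := exists_isProd (𝒢 := 𝒢) (f₁ := fun z : W × (V × W) => ψ (T z.2, z.1))
    (f₂ := fun z => ψ z.2) (v := 0) (x := c 0)
    (h.chart_arrows.dSmooth.comp (ContDiff.dSmooth (by fun_prop)))
    (h.chart_arrows.dSmooth.comp contDiff_snd.dSmooth)
    ((congrArg ψ (show (T 0, (0 : W)) = 0 from Prod.ext hT0 rfl)).trans hψ0) hψ0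
    (by
      filter_upwards [hsnd.eventually hcT] with z hz
      rw [h.src_eq, hz, Function.comp_apply])
  obtain ⟨κ, hκ, hκ0, hψκ⟩ := h.chart_arrows.exists_lift hk (v := 0) (a := 0)
    (hk0.trans hψ0.symm)
  -- In the chart, right multiplication by a unit is the identity.
  have hκ1 : ∀ᶠ b in 𝓝 (0 : W), (κ (b, 0)).2 = b := by
    have hlim : Filter.Tendsto (fun b : W => (b, (0 : V × W))) (𝓝 0) (𝓝 0) :=
      (Continuous.prodMk_left _).tendsto 0
    filter_upwards [hlim.eventually hkm, hlim.eventually hψκ] with b h1 h2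
    simp only [hψ0] at h1
    have h3 := h.chart_arrows.injective (h2.trans h1.eq_of_unit_right)
    rw [h3]
  let F : W × (V × W) → W × (V × W) := fun z => ((κ z).2, z.2)
  have hF : ContDiff ℝ ∞ F := (contDiff_snd.comp hκ).prodMk contDiff_snd
  have hF0 : F 0 = 0 := by simp [F, hκ0]
  have hinj : Function.Injective (fderiv ℝ F 0) := by
    have hdκ : HasFDerivAt (fun z => (κ z).2)
        ((ContinuousLinearMap.snd ℝ V W).comp (fderiv ℝ κ 0)) 0 :=
      hasFDerivAt_snd.comp 0 (hκ.contDiffAt.differentiableAt (by simp)).hasFDerivAt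
    have hdF : HasFDerivAt F _ 0 := hdκ.prodMk hasFDerivAt_snd
    have h1 := (HasFDerivAt.comp (g := fun z => (κ z).2) (f := fun b : W => (b, (0 : V × W)))
      (0 : W) hdκ (hasFDerivAt_prodMk_left (0 : W) (0 : V × W))).unique
      ((hasFDerivAt_id (0 : W)).congr_of_eventuallyEq hκ1)
    rw [hdF.fderiv]
    refine (injective_iff_map_eq_zero _).2 fun ⟨b, x⟩ hbx => ?_
    have h2 : x = 0 := congrArg Prod.snd hbx
    subst h2
    have h3 : (fderiv ℝ κ 0 (b, 0)).2 = b := congrArg (fun L => L b) h1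
    have h4 : (fderiv ℝ κ 0 (b, 0)).2 = 0 := congrArg Prod.fst hbx
    rw [← h3, h4]
    rfl
  have hgood : ∀ᶠ z in 𝓝 (0 : W × (V × W)),
      𝒢.IsProd (ψ (T z.2, z.1)) (ψ z.2) (ψ (κ z)) := by
    filter_upwards [hkm, hψκ] with z h1 h2
    rwa [h2]
  obtain ⟨e, he0, heF, heP, hes⟩ := hF.exists_openPartialHomeomorph hinj rfl hgood
  have hlim : Filter.Tendsto (fun x : V × W => ((0 : W), x)) (𝓝 0) (𝓝 0) :=
    (Continuous.prodMk_right _).tendsto 0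
  have htarget : ∀ᶠ x in 𝓝 (0 : V × W), ((0 : W), x) ∈ e.target := by
    refine hlim.eventually_mem ?_
    have h1 := e.open_target.mem_nhds (e.map_source he0)
    rwa [heF, hF0] at h1
  obtain ⟨B, hB, hBe⟩ := exists_contDiff_eventuallyEq (f := fun x : V × W => (e.symm (0, x)).1)
    (v := 0) (by
      filter_upwards [htarget] with x hx
      exact contDiffAt_fst.comp x (ContDiffAt.comp x (hes.contDiffAt (e.open_target.mem_nhds hx))
        (contDiffAt_const.prodMk contDiffAt_id)))
  refine ⟨fun x => (T x, B x), hT.prodMk hB, ?_, ?_⟩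
  · have h1 := e.left_inv he0
    rw [heF, hF0] at h1
    exact Prod.ext hT0 (hBe.self_of_nhds.trans (congrArg Prod.fst h1))
  · filter_upwards [htarget, hBe] with x hx hBx
    have h1 := e.right_inv hx
    rw [heF] at h1
    have h2 : (e.symm (0, x)).2 = x := congrArg Prod.snd h1
    have h3 : (κ (e.symm (0, x))).2 = 0 := congrArg Prod.fst h1
    have h4 := heP _ (e.map_target hx)
    rw [h2, ← hBx] at h4
    have h5 : (κ (e.symm (0, x))).1 = x.1 := by
      refine h.chart_objects.injective ?_
      rw [← h.src_eq (κ (e.symm (0, x))).1 (κ (e.symm (0, x))).2, ← h.src_eq x.1 x.2]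
      exact h4.src_eq
    have h6 : ψ (κ (e.symm (0, x))) = 𝒢.unit (c x.1) := by
      rw [← h.unit_eq]
      exact congrArg ψ (Prod.ext h5 h3)
    rwa [h6] at h4

end SourceCharts

end LocalDiffeologicalGroupoid

/-! ### The source fiber of a unit -/

namespace DiffeologicalGroupoid

variable {G M : Type*} [DiffeologicalSpace G] [DiffeologicalSpace M]
  (𝒢 : DiffeologicalGroupoid G M)

theorem toLocal_isProd (g h : G) (e : 𝒢.src g = 𝒢.tgt h) :
    𝒢.toLocal.IsProd g h (𝒢.mul ⟨(g, h), e⟩) :=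
  ⟨e, Set.mem_univ _, rfl⟩

variable {𝒢}

/-- A left inverse of an arrow of a groupoid is a right inverse. -/
theorem toLocal_isProd_unit_comm {j g k : G} {x : M} (h : 𝒢.toLocal.IsProd j g (𝒢.unit x))
    (hk : 𝒢.toLocal.IsProd g j k) : k = 𝒢.unit (𝒢.tgt g) := by
  have h1 : 𝒢.toLocal.IsProd g (𝒢.inv g) (𝒢.unit (𝒢.tgt g)) :=
    ⟨(𝒢.tgt_inv g).symm, Set.mem_univ _, 𝒢.mul_inv g⟩
  have h2 := 𝒢.toLocal_isProd j (𝒢.unit (𝒢.tgt g)) (h.src_eq_tgt.trans (𝒢.tgt_unit _).symm)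
  have h3 : 𝒢.src (𝒢.unit x) = 𝒢.src g := h.src_eq
  have h4 := 𝒢.toLocal_isProd (𝒢.unit x) (𝒢.inv g) (h3.trans (𝒢.tgt_inv g).symm)
  have h5 : j = 𝒢.inv g := by
    have h6 := h.assoc h1 h2 h4
    rw [LocalDiffeologicalGroupoid.IsProd.eq_of_unit_left (𝒢 := 𝒢.toLocal) h4] at h6
    rw [← h6]
    exact (LocalDiffeologicalGroupoid.IsProd.eq_of_unit_right (𝒢 := 𝒢.toLocal) h2).symm
  rw [h5] at hk
  exact hk.unique h1

end DiffeologicalGroupoid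

namespace LocalDiffeologicalGroupoid

variable {V W G G' M : Type*}
  [NormedAddCommGroup V] [NormedSpace ℝ V] [FiniteDimensional ℝ V]
  [DiffeologicalSpace V] [IsContDiffCompatible V]
  [NormedAddCommGroup W] [NormedSpace ℝ W] [FiniteDimensional ℝ W]
  [DiffeologicalSpace W] [IsContDiffCompatible W]
  [DiffeologicalSpace G] [DiffeologicalSpace G'] [DiffeologicalSpace M]
  {𝒢 : DiffeologicalGroupoid G M} {𝒢' : LocalDiffeologicalGroupoid G' M} {π : G' → G}

/-- A neighbourhood of the units on which a germ of a morphism over the identity of the objects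
respects sources, targets, units and products. -/
theorem IsGermMorphism.exists_isDOpen (h : 𝒢'.IsGermMorphism 𝒢.toLocal π id) :
    ∃ S : Set G', IsDOpen S ∧ (∀ x, 𝒢'.unit x ∈ S) ∧ (∀ x, π (𝒢'.unit x) = 𝒢.unit x) ∧
      (∀ g ∈ S, 𝒢.src (π g) = 𝒢'.src g) ∧ (∀ g ∈ S, 𝒢.tgt (π g) = 𝒢'.tgt g) ∧
      ∀ g ∈ S, ∀ k ∈ S, ∀ l ∈ S, 𝒢'.IsProd g k l → 𝒢.toLocal.IsProd (π g) (π k) (π l) := by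
  obtain ⟨hu, S, hS, huS, -, hst, hmul⟩ := h
  have hu' : ∀ x, 𝒢'.unit x ∈ S := fun x => huS ⟨x, rfl⟩
  refine ⟨S, hS, hu', fun x => ?_, fun g hg => (hst g hg).1, fun g hg => (hst g hg).2, ?_⟩
  · obtain ⟨y, hy⟩ := hu ⟨x, rfl⟩
    have h1 : 𝒢.src (π (𝒢'.unit x)) = 𝒢'.src (𝒢'.unit x) := (hst _ (hu' x)).1
    rw [← hy, 𝒢'.src_unit] at h1
    have h2 : y = x := (𝒢.src_unit y).symm.trans h1
    rw [← hy, h2]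
    rfl
  · rintro g hg k hk _ hl ⟨e, m, rfl⟩
    have e' : 𝒢.src (π g) = 𝒢.tgt (π k) :=
      ((hst g hg).1.trans e).trans (hst k hk).2.symm
    exact ⟨e', Set.mem_univ _, (hmul g hg k hk e m hl e' (Set.mem_univ _)).symm⟩

variable {c : V → M} {r : M → V} {ψ : V × W → G'} {ρ : G' → V × W}

/-- Self-maps of a source fiber near a unit that preserve `π` have a common germ. Let `e` be such a
self-map. A conjugate `q⁻¹ e(q x)` depends on an arrow `q` near the units with source the target of
`x`, but its image under `π` does not; hence it is the same for all `q` close to the units, as the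
unit fibers of `π` are totally disconnected. It is `e(x)` for `q` a unit, and for `q` the inverse
of `x` it does not involve `e`. -/
theorem IsSourceChart.exists_germ_eq (h : 𝒢'.IsSourceChart c r ψ ρ)
    (hπ : 𝒢'.IsGermMorphism 𝒢.toLocal π id)
    (hfib : ∀ x : M, IsDTotallyDisconnected (π ⁻¹' {𝒢.unit x})) :
    ∃ J : W → G', ∀ e : W → W, ContDiff ℝ ∞ e → e 0 = 0 →
      (∀ᶠ x in 𝓝 0, π (ψ (0, e x)) = π (ψ (0, x))) → ∀ᶠ x in 𝓝 0, ψ (0, e x) = J x := by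
  obtain ⟨S, hS, hSu, hπu, hπs, hπt, hπm⟩ := hπ.exists_isDOpen
  obtain ⟨I, hI, hI0, hIm⟩ := h.exists_left_inverse
  have hψ := h.chart_arrows.dSmooth
  have hψ0 : ψ (0, 0) = 𝒢'.unit (c 0) := h.unit_eq 0
  have hψ0' : ψ 0 = 𝒢'.unit (c 0) := hψ0
  let o : W → G' := fun x => ψ (0, x)
  have hinr : ContDiff ℝ ∞ (fun x : W => ((0 : V), x)) := by fun_prop
  have ho : DSmooth o := hψ.comp hinr.dSmooth
  have ho_inj : ∀ x y, o x = o y → x = y := fun x y hxy =>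
    congrArg Prod.snd (h.chart_arrows.injective hxy)
  have hinr_lim : Filter.Tendsto (fun x : W => ((0 : V), x)) (𝓝 0) (𝓝 0) :=
    (Continuous.prodMk_right _).tendsto 0
  have hI00 : I (0, 0) = 0 := hI0
  -- The left inverse of `o x` is `ψ (v x, ι x)`.
  let v : W → V := fun x => (I (0, x)).1
  let ι : W → W := fun x => (I (0, x)).2
  have hv : ContDiff ℝ ∞ v := contDiff_fst.comp (hI.comp hinr)
  have hι : ContDiff ℝ ∞ ι := contDiff_snd.comp (hI.comp hinr)
  have hv0 : v 0 = 0 := by simp [v, hI00]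
  have hι0 : ι 0 = 0 := by simp [ι, hI00]
  let j : W → G' := fun x => ψ (v x, ι x)
  have hj : DSmooth j := hψ.comp (hv.prodMk hι).dSmooth
  have hj0 : j 0 = 𝒢'.unit (c 0) := by simp only [j, hv0, hι0, hψ0]
  have H1 : ∀ᶠ x in 𝓝 0, 𝒢'.IsProd (j x) (o x) (𝒢'.unit (c 0)) := hinr_lim.eventually hIm
  -- The arrows `q (b, x)` have source the target of `o x`.
  let vq : W × W → V × W := fun z => (v z.2, z.1)
  have hvq : ContDiff ℝ ∞ vq := (hv.comp contDiff_snd).prodMk contDiff_fst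
  have hvq0 : vq 0 = 0 := Prod.ext hv0 rfl
  have hvq_lim : Filter.Tendsto vq (𝓝 0) (𝓝 0) := by
    have := hvq.continuous.tendsto 0
    rwa [hvq0] at this
  let q : W × W → G' := fun z => ψ (vq z)
  let i : W × W → G' := fun z => ψ (I (vq z))
  have hq : DSmooth q := hψ.comp hvq.dSmooth
  have hi : DSmooth i := hψ.comp (hI.comp hvq).dSmooth
  have hq0 : q 0 = 𝒢'.unit (c 0) := by simp only [q, hvq0, hψ0']
  have hi0 : i 0 = 𝒢'.unit (c 0) := by simp only [i, hvq0, hI0, hψ0']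
  have H2 : ∀ᶠ z in 𝓝 0, 𝒢'.IsProd (i z) (q z) (𝒢'.unit (c (v z.2))) := hvq_lim.eventually hIm
  have hsnd : Filter.Tendsto (Prod.snd : W × W → W) (𝓝 0) (𝓝 0) := continuous_snd.tendsto 0
  have H1' : ∀ᶠ z in 𝓝 (0 : W × W), 𝒢'.IsProd (j z.2) (o z.2) (𝒢'.unit (c 0)) :=
    hsnd.eventually H1
  have ho' : DSmooth fun z : W × W => o z.2 := ho.comp contDiff_snd.dSmooth
  obtain ⟨α, hα, hα0, hαm⟩ := exists_isProd (v := 0) hq ho' hq0 hψ0 (by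
    filter_upwards [H1'] with z hz
    rw [← hz.src_eq_tgt]
    exact (h.src_eq _ _).trans (h.src_eq _ _).symm)
  obtain ⟨A', hA', hA0, hψA⟩ := h.chart_arrows.exists_lift hα (v := 0) (a := 0)
    (hα0.trans hψ0'.symm)
  let A : W × W → W := fun z => (A' z).2
  have hA : ContDiff ℝ ∞ A := contDiff_snd.comp hA'
  have hA00 : A 0 = 0 := by simp [A, hA0]
  have hA_lim : Filter.Tendsto A (𝓝 0) (𝓝 0) := by
    have := hA.continuous.tendsto 0
    rwa [hA00] at this
  have H3 : ∀ᶠ z in 𝓝 0, 𝒢'.IsProd (q z) (o z.2) (o (A z)) := by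
    filter_upwards [hαm, hψA] with z h1 h2
    rw [← h2] at h1
    have h3 : (A' z).1 = 0 := h.chart_objects.injective (by
      rw [← h.src_eq (A' z).1 (A' z).2, ← h.src_eq 0 z.2]
      exact h1.src_eq)
    have h4 : ψ (A' z) = o (A z) := congrArg ψ (Prod.ext h3 rfl)
    rwa [h4] at h1
  refine ⟨fun x => i (ι x, x), fun e he he0 heπ => ?_⟩
  have hoe : DSmooth fun z => o (e (A z)) := ho.comp (he.comp hA).dSmooth
  have hoe0 : o (e (A 0)) = 𝒢'.unit (c 0) := by rw [hA00, he0]; exact hψ0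
  have hoA : DSmooth fun z => o (A z) := ho.comp hA.dSmooth
  have hoA0 : o (A 0) = 𝒢'.unit (c 0) := by rw [hA00]; exact hψ0
  -- Arrows depending smoothly on `z` that are a unit for `z = 0` lie in `S` for small `z`.
  have hmem : ∀ f : W × W → G', DSmooth f → f 0 = 𝒢'.unit (c 0) → ∀ᶠ z in 𝓝 0, f z ∈ S :=
    fun f hf hf0 => hS.eventually hf (by rw [hf0]; exact hSu _)
  have hπe : ∀ᶠ z in 𝓝 0, π (o (e (A z))) = π (o (A z)) := hA_lim.eventually heπ
  obtain ⟨E, hE, hE0, H4⟩ := exists_isProd hi hoe hi0 hoe0 (by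
    filter_upwards [H2, H3, hπe, hmem _ hoe hoe0, hmem _ hoA hoA0] with z h2 h3 h4 h5 h6
    rw [h2.src_eq_tgt, ← h3.tgt_eq, ← hπt _ h5, ← hπt _ h6, h4])
  have hj' : DSmooth fun z : W × W => j z.2 := hj.comp contDiff_snd.dSmooth
  have hEsrc : ∀ᶠ z in 𝓝 0, 𝒢'.src (E z) = c 0 := by
    filter_upwards [H4] with z h4
    rw [h4.src_eq]
    exact h.src_eq _ _
  obtain ⟨D, hD, hD0, H5⟩ := exists_isProd hE hj' hE0 hj0 (by
    filter_upwards [H1', hEsrc] with z h1 h2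
    rw [h2, ← h1.tgt_eq, 𝒢'.tgt_unit])
  -- `E` can be recovered from `D`.
  have H6 : ∀ᶠ z in 𝓝 0, 𝒢'.IsProd (D z) (o z.2) (E z) := by
    obtain ⟨F, -, -, hF⟩ := exists_isProd hD ho' hD0 hψ0 (by
      filter_upwards [H1', H5] with z h1 h5
      rw [h5.src_eq, h1.src_eq_tgt])
    obtain ⟨F', -, -, hF'⟩ := exists_isProd hE (dSmooth_const (y := 𝒢'.unit (c 0))) hE0 rfl (by
      filter_upwards [hEsrc] with z h1
      rw [h1, 𝒢'.tgt_unit])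
    filter_upwards [H1', H5, hF, hF'] with z h1 h5 h6 h7
    have h8 := h5.assoc h1 h7 h6
    rwa [← h8, h7.eq_of_unit_right] at h6
  -- `D` takes values in the fibers of `π` over units.
  have H7 : ∀ᶠ z in 𝓝 0, D z ∈ π ⁻¹' {𝒢.unit (𝒢'.tgt (o z.2))} := by
    filter_upwards [H1', H2, H3, H4, H5, hπe, hmem _ hoe hoe0, hmem _ hoA hoA0, hmem _ hE hE0,
      hmem _ hD hD0, hmem _ hi hi0, hmem _ hq hq0, hmem _ hj' hj0, hmem _ ho' hψ0]
      with z h1 h2 h3 h4 h5 h6 moe moA mE mD mi mq mj mo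
    have p1 := hπm _ mj _ mo _ (hSu _) h1
    have p2 := hπm _ mi _ mq _ (hSu _) h2
    have p3 := hπm _ mq _ mo _ moA h3
    have p4 := hπm _ mi _ moe _ mE h4
    have p5 := hπm _ mE _ mj _ mD h5
    rw [hπu] at p1 p2
    rw [h6] at p4
    have p6 := 𝒢.toLocal_isProd (𝒢.unit (c (v z.2))) (π (o z.2))
      (p2.src_eq.trans p3.src_eq_tgt)
    have p7 := p2.assoc p3 p4 p6
    rw [IsProd.eq_of_unit_left (𝒢 := 𝒢.toLocal) p6] at p7
    rw [p7] at p5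
    rw [Set.mem_preimage, Set.mem_singleton_iff, ← hπt _ mo]
    exact DiffeologicalGroupoid.toLocal_isProd_unit_comm p1 p5
  obtain ⟨ε, hε, hball⟩ := Metric.eventually_nhds_iff_ball.1 (H2.and (H3.and (H4.and (H6.and H7))))
  have hball' : ∀ b ∈ Metric.ball (0 : W) ε, ∀ x ∈ Metric.ball (0 : W) ε,
      (b, x) ∈ Metric.ball (0 : W × W) ε := fun b hb x hx => by
    change (b, x) ∈ Metric.ball ((0 : W), (0 : W)) ε
    rw [← ball_prod_same]
    exact ⟨hb, hx⟩
  have hι_ball : ∀ᶠ x in 𝓝 0, ι x ∈ Metric.ball (0 : W) ε :=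
    hι.continuous.continuousAt.eventually_mem (by
      rw [hι0]
      exact Metric.ball_mem_nhds _ hε)
  filter_upwards [hι_ball, Metric.ball_mem_nhds _ hε, H1] with x hxι hx h1
  have h0 : (0 : W) ∈ Metric.ball (0 : W) ε := Metric.mem_ball_self hε
  have hDx : D (0, x) = D (ι x, x) := (hfib (𝒢'.tgt (o x))).eq_of_segment
    (f := fun b => D (b, x)) (hD.comp (ContDiff.dSmooth (by fun_prop))) fun b hb =>
      (hball _ (hball' b ((convex_ball 0 ε).segment_subset h0 hxι hb) x hx)).2.2.2.2
  obtain ⟨a2, a3, a4, a6, -⟩ := hball _ (hball' 0 h0 x hx)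
  obtain ⟨b2, b3, b4, b6, -⟩ := hball _ (hball' (ι x) hxι x hx)
  have hEx : E (0, x) = E (ι x, x) := by
    rw [hDx] at a6
    exact a6.unique b6
  have hE1 : E (0, x) = o (e x) := by
    have h2 : q (0, x) = 𝒢'.unit (c (v x)) := h.unit_eq _
    rw [h2] at a2 a3
    have h3 : A (0, x) = x := ho_inj _ _ a3.eq_of_unit_left
    rw [← a2.eq_of_unit_right, h3] at a4
    exact a4.eq_of_unit_left
  have hE2 : E (ι x, x) = i (ι x, x) := by
    have h2 : q (ι x, x) = j x := rfl
    rw [h2] at b3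
    have h3 : A (ι x, x) = 0 := ho_inj _ _ ((b3.unique h1).trans hψ0.symm)
    rw [h3, he0, show o 0 = 𝒢'.unit (c 0) from hψ0] at b4
    exact b4.eq_of_unit_right
  exact hE1.symm.trans (hEx.trans hE2)

/-- Along the source fiber of a unit, `π` is quasi-étale at the unit. -/
theorem IsSourceChart.isQuasiEtaleAt (h : 𝒢'.IsSourceChart c r ψ ρ)
    (hπ : 𝒢'.IsGermMorphism 𝒢.toLocal π id)
    (hfib : ∀ x : M, IsDTotallyDisconnected (π ⁻¹' {𝒢.unit x})) :
    IsQuasiEtaleAt (fun w => π (ψ (0, w))) 0 := by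
  refine ⟨fun n k hk w₀ hw₀ hc => ?_, fun e he he0 heπ => ?_⟩
  · obtain ⟨ρ', hρ', hρf, hρv⟩ := exists_smooth_retraction_near w₀ hc
    obtain ⟨-, -, -, hπu, -⟩ := hπ.exists_isDOpen
    have hfx := hfib (c 0)
    rw [← hπu, ← h.unit_eq] at hfx
    have h1 := hfx n (fun w => ⟨ψ (0, k (ρ' w)), hρf w⟩)
      (h.chart_arrows.dSmooth.comp (ContDiff.dSmooth (f := fun w => ((0 : V), k (ρ' w)))
        (by fun_prop))).isPlot
    filter_upwards [(IsLocallyConstant.iff_eventually_eq _).1 h1 w₀, hρv] with w h2 h3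
    have h4 := congrArg Subtype.val h2
    simp only [h3, hρv.self_of_nhds, hw₀] at h4
    exact congrArg Prod.snd (h.chart_arrows.injective h4)
  · obtain ⟨J, hJ⟩ := h.exists_germ_eq hπ hfib
    have h1 : ∀ᶠ x in 𝓝 (0 : W), e x = x := by
      filter_upwards [hJ e he he0 heπ, hJ id contDiff_id rfl (by simp)] with x h2 h3
      exact congrArg Prod.snd (h.chart_arrows.injective (h2.trans h3.symm))
    have h2 : fderiv ℝ e 0 = ContinuousLinearMap.id ℝ W :=
      ((hasFDerivAt_id 0).congr_of_eventuallyEq h1).fderiv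
    rw [h2]
    exact fun _ _ hxy => hxy

end LocalDiffeologicalGroupoid

/-! ### Fibered charts and fiber products -/

section FiberedCharts

variable {V W X Y M : Type*}
  [NormedAddCommGroup V] [NormedSpace ℝ V] [FiniteDimensional ℝ V]
  [DiffeologicalSpace V] [IsContDiffCompatible V]
  [NormedAddCommGroup W] [NormedSpace ℝ W] [FiniteDimensional ℝ W]
  [DiffeologicalSpace W] [IsContDiffCompatible W]
  [DiffeologicalSpace X] [DiffeologicalSpace Y] [DiffeologicalSpace M]

theorem IsDChart.isQuasiEtaleAt {c : V → X} {r : X → V} (h : IsDChart c r) (a : V) :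
    IsQuasiEtaleAt c a := by
  refine ⟨fun n k _ v _ hc => hc.mono fun _ hw => h.injective hw, fun k _ _ hc => ?_⟩
  have h1 : ∀ᶠ v in 𝓝 a, k v = v := hc.mono fun _ hw => h.injective hw
  have h2 : fderiv ℝ k a = ContinuousLinearMap.id ℝ V :=
    ((hasFDerivAt_id a).congr_of_eventuallyEq h1).fderiv
  rw [h2]
  exact fun _ _ hxy => hxy

theorem ContinuousLinearEquiv.liftsThrough (e : V ≃L[ℝ] W) : LiftsThrough Set.univ e :=
  fun _ p hp _ _ a ha => ⟨e.symm ∘ p, (e.symm.contDiff.comp hp.contDiff).isPlot,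
    by simp [ha], by simp⟩

/-- Precomposition with a linear isomorphism preserves charts quasi-étale at every point. -/
theorem IsQuasiEtaleAt.comp_equiv {φ : W → X} (hφ : DSmooth φ) (hl : LiftsThrough Set.univ φ)
    (hq : ∀ w, IsQuasiEtaleAt φ w) (e : V ≃L[ℝ] W) (v : V) : IsQuasiEtaleAt (φ ∘ e) v :=
  (hq (e v)).of_liftsThrough (hφ.comp e.contDiff.dSmooth) hφ (fun _ => Set.mem_univ _)
    (fun _ => Set.mem_univ _) (hl.comp e.liftsThrough) hl rfl e.toLinearEquiv.finrank_eq

/-- A chart `Φ` of `X` over a chart `c` of the manifold `M`, in which `p : X → M` is the first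
projection, and which is quasi-étale along each fiber of `p`. -/
structure IsFiberedChart (p : X → M) (c : V → M) (r : M → V) (Φ : V × W → X) : Prop where
  chart_base : IsDChart c r
  dSmooth : DSmooth Φ
  liftsThrough : LiftsThrough Set.univ Φ
  comm : ∀ v w, p (Φ (v, w)) = c v
  isQuasiEtaleAt_slice : ∀ v w, IsQuasiEtaleAt (fun w => Φ (v, w)) w

theorem IsFiberedChart.isQuasiEtaleAt {p : X → M} {c : V → M} {r : M → V} {Φ : V × W → X}
    (h : IsFiberedChart p c r Φ) (a : V × W) : IsQuasiEtaleAt Φ a :=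
  (h.chart_base.isQuasiEtaleAt a.1).of_slice (h.isQuasiEtaleAt_slice a.1 a.2) h.comm

/-- If `Φ` lifts plots and is fibered over an injective map, its slices lift the plots in the
fibers. -/
theorem LiftsThrough.slice {p : X → M} {c : V → M} {Φ : V × W → X} (hl : LiftsThrough Set.univ Φ)
    (hc : Function.Injective c) (hΦ : ∀ v w, p (Φ (v, w)) = c v) (v : V) :
    LiftsThrough (p ⁻¹' {c v}) (fun w => Φ (v, w)) := by
  intro n P hP hPv x a hx
  obtain ⟨q, hq, hqx, hΦq⟩ := hl n P hP (fun _ => Set.mem_univ _) x (v, a) hx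
  refine ⟨fun w => (q w).2, dSmooth_snd _ _ hq, congrArg Prod.snd hqx, ?_⟩
  filter_upwards [hΦq] with w hw
  have h1 : (q w).1 = v := hc (by
    rw [← hΦ _ (q w).2, Prod.mk.eta, hw]
    exact hPv w)
  rw [← hw]
  exact congrArg Φ (Prod.ext h1.symm rfl)

/-- The base change of a fibered chart of `X` along a chart of `Y` is a chart of the fiber
product. -/
theorem IsFiberedChart.exists_chart_fiberProd {U : Type*} [NormedAddCommGroup U]
    [NormedSpace ℝ U] [FiniteDimensional ℝ U] [DiffeologicalSpace U] [IsContDiffCompatible U]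
    {p : X → M} {c : V → M} {r : M → V} {Φ : V × W → X} (h : IsFiberedChart p c r Φ) {f : Y → M}
    {χ : U → Y} (hχ : DSmooth χ) (hl : LiftsThrough Set.univ χ)
    (hq : ∀ a, IsQuasiEtaleAt χ a) {F : U → V} (hF : ContDiff ℝ ∞ F)
    (hcF : ∀ a, c (F a) = f (χ a)) :
    ∃ Ψ : U × W → FiberProd p f, DSmooth Ψ ∧ LiftsThrough Set.univ Ψ ∧
      (∀ a, IsQuasiEtaleAt Ψ a) ∧ ∀ a w, (Ψ (a, w)).1 = (Φ (F a, w), χ a) := by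
  let Ψ : U × W → FiberProd p f := fun z =>
    ⟨(Φ (F z.1, z.2), χ z.1), (h.comm _ _).trans (hcF _)⟩
  refine ⟨Ψ, ?_, ?_, ?_, fun _ _ => rfl⟩
  · refine dSmooth_subtype_iff.2 (DSmooth.prodMk (h.dSmooth.comp ?_)
      (hχ.comp contDiff_fst.dSmooth))
    exact ((hF.comp contDiff_fst).prodMk contDiff_snd).dSmooth
  · intro n P hP _ x a hx
    have hx' := congrArg Subtype.val hx
    have hP' : DSmooth fun w => (P w).1 := dSmooth_subtypeVal.comp hP.dSmooth
    obtain ⟨q, hq, hqx, hχq⟩ := hl n (fun w => (P w).1.2) (dSmooth_snd.comp hP').isPlot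
      (fun _ => Set.mem_univ _) x a.1 (congrArg Prod.snd hx')
    obtain ⟨s, hs, hsx, hΦs⟩ := h.liftsThrough n (fun w => (P w).1.1)
      (dSmooth_fst.comp hP').isPlot (fun _ => Set.mem_univ _) x (F a.1, a.2)
      (congrArg Prod.fst hx')
    refine ⟨fun w => (q w, (s w).2), (hq.dSmooth.prodMk (dSmooth_snd.comp hs.dSmooth)).isPlot,
      by simp only [hqx, hsx], ?_⟩
    filter_upwards [hχq, hΦs] with w h1 h2
    have h3 : (s w).1 = F (q w) := h.chart_base.injective (by
      rw [hcF, h1, ← (P w).2, ← h2]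
      exact (h.comm _ _).symm)
    refine Subtype.ext (Prod.ext ?_ h1)
    rw [← h2]
    exact congrArg Φ (Prod.ext h3.symm rfl)
  · intro a
    refine (hq a.1).of_slice (p := fun z => z.1.2) ?_ fun _ _ => rfl
    exact IsQuasiEtaleAt.of_comp (g := fun z : FiberProd p f => z.1.1)
      (h.isQuasiEtaleAt_slice (F a.1) a.2)

end FiberedCharts

section QUED

/-- The diffeology of a space in a higher universe. -/
instance ULift.instDiffeologicalSpace {X : Type*} [d : DiffeologicalSpace X] :
    DiffeologicalSpace (ULift.{u} X) :=
  DiffeologicalSpace.pullback ULift.down d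

theorem isSmoothManifold_uLift_euclideanSpace (n : ℕ) :
    IsSmoothManifold (ULift.{u} (EuclideanSpace ℝ (Fin n))) := by
  have he : Topology.IsOpenEmbedding (ULift.down : ULift.{u} (EuclideanSpace ℝ (Fin n)) → _) :=
    Homeomorph.ulift.isOpenEmbedding
  let _ : ChartedSpace (EuclideanSpace ℝ (Fin n)) (ULift.{u} (EuclideanSpace ℝ (Fin n))) :=
    he.singletonChartedSpace
  refine ⟨n, inferInstance, inferInstance, inferInstance, he.secondCountableTopology,
    he.isManifold_singleton, fun k p => ?_⟩
  change ContDiff ℝ ∞ (ULift.down ∘ p) ↔ _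
  rw [← contMDiff_iff_contDiff]
  exact ⟨fun h => h.of_comp_isOpenEmbedding he, fun h => (contMDiff_isOpenEmbedding he).comp h⟩

theorem isDChart_uLift_up (n : ℕ) :
    IsDChart (ULift.up : _ → ULift.{u} (EuclideanSpace ℝ (Fin n))) ULift.down where
  dSmooth := fun _ _ hp => hp
  left_inv _ := rfl
  contDiffAt _ p hp _ _ :=
    (show ContDiff ℝ ∞ (ULift.down ∘ p) from hp).contDiffAt
  isDOpen_range := by
    rw [ULift.up_surjective.range_eq]
    exact isDOpen_univ_diffeology

/-- A space covered by quasi-étale charts defined on Euclidean spaces is a `QUED`. -/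
theorem isQUED_of_exists_chart {X : Type u} [DiffeologicalSpace X]
    (h : ∀ x : X, ∃ (n : ℕ) (φ : EuclideanSpace ℝ (Fin n) → X), DSmooth φ ∧
      LiftsThrough Set.univ φ ∧ (∀ a, IsQuasiEtaleAt φ a) ∧ x ∈ Set.range φ) : IsQUED X := by
  intro x
  obtain ⟨n, φ, hφ, hl, hq, a, ha⟩ := h x
  have hdown : DSmooth (ULift.down : ULift.{u} (EuclideanSpace ℝ (Fin n)) → _) :=
    fun _ _ hp => hp
  have hl' : LiftsThrough Set.univ (φ ∘ ULift.down : ULift.{u} (EuclideanSpace ℝ (Fin n)) → X) :=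
    hl.comp fun k p hp _ v b hb => ⟨ULift.up ∘ p, hp, congrArg ULift.up hb, by simp⟩
  refine ⟨ULift.{u} (EuclideanSpace ℝ (Fin n)), inferInstance, φ ∘ ULift.down,
    isSmoothManifold_uLift_euclideanSpace n, ?_, ⟨⟨a⟩, ha⟩⟩
  refine (hl'.isLocalSubduction (hφ.comp hdown)).isQuasiEtale
    (fun y => ⟨_, _, y.down, isDChart_uLift_up n, rfl⟩) fun c r hc b => ?_
  exact (hq (c b).down).of_liftsThrough ((hφ.comp hdown).comp hc.dSmooth) hφ
    (fun _ => Set.mem_univ _) (fun _ => Set.mem_univ _) (hl'.comp hc.liftsThrough) hl rfl rfl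

theorem isQUED_of_exists_isDChart {M : Type u} [DiffeologicalSpace M] {m : ℕ}
    (hM : ∀ x : M, ∃ (c : EuclideanSpace ℝ (Fin m) → M) (r : M → EuclideanSpace ℝ (Fin m)),
      IsDChart c r ∧ c 0 = x) : IsQUED M :=
  isQUED_of_exists_chart fun x =>
    let ⟨c, _, hc, hcx⟩ := hM x
    ⟨m, c, hc.dSmooth, hc.liftsThrough, hc.isQuasiEtaleAt, 0, hcx⟩

variable {X Y M : Type u} [DiffeologicalSpace X] [DiffeologicalSpace Y] [DiffeologicalSpace M]

/-- The map `p` has fibered charts of fixed dimensions around each point. -/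
def HasFiberedCharts (p : X → M) (m k : ℕ) : Prop :=
  ∀ x : X, ∃ (c : EuclideanSpace ℝ (Fin m) → M) (r : M → EuclideanSpace ℝ (Fin m))
    (Φ : EuclideanSpace ℝ (Fin m) × EuclideanSpace ℝ (Fin k) → X),
    IsFiberedChart p c r Φ ∧ x ∈ Set.range Φ

theorem exists_prodEquiv (n k : ℕ) : Nonempty (EuclideanSpace ℝ (Fin (n + k)) ≃L[ℝ]
    EuclideanSpace ℝ (Fin n) × EuclideanSpace ℝ (Fin k)) :=
  ⟨ContinuousLinearEquiv.ofFinrankEq (by simp)⟩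

theorem HasFiberedCharts.isQUED {p : X → M} {m k : ℕ} (h : HasFiberedCharts p m k) :
    IsQUED X := by
  obtain ⟨e⟩ := exists_prodEquiv m k
  refine isQUED_of_exists_chart fun x => ?_
  obtain ⟨c, r, Φ, hΦ, a, ha⟩ := h x
  exact ⟨m + k, Φ ∘ e, hΦ.dSmooth.comp e.contDiff.dSmooth, hΦ.liftsThrough.comp e.liftsThrough,
    IsQuasiEtaleAt.comp_equiv hΦ.dSmooth hΦ.liftsThrough hΦ.isQuasiEtaleAt e, e.symm a,
    by simpa using ha⟩

open OpenPartialHomeomorph in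
theorem HasFiberedCharts.isQUED_fiberProd {p : X → M} {m k : ℕ} (h : HasFiberedCharts p m k)
    (hY : IsQUED Y) {f : Y → M} (hf : DSmooth f) : IsQUED (FiberProd p f) := by
  refine isQUED_of_exists_chart fun x => ?_
  obtain ⟨c, r, Φ, hΦ, a, ha⟩ := h x.1.1
  obtain ⟨N, _, π, ⟨n, _, _, -, -, _, hN⟩, hπ, y, hy⟩ := hY x.1.2
  obtain ⟨C, R, hC, hC0⟩ := exists_isDChart_of_isManifold hN y
  have hfC := hf.comp (hπ.isLocalSubduction.1.comp hC.dSmooth)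
  have hc0 : f (π (C 0)) = c a.1 := by
    rw [hC0, hy, ← x.2, ← ha]
    exact hΦ.comm a.1 a.2
  -- Shrink the chart of `Y` so that its image in `M` is contained in the range of `c`.
  obtain ⟨ε, hε, hball⟩ := Metric.eventually_nhds_iff_ball.1
    (hΦ.chart_base.isDOpen_range.eventually hfC (v := 0) ⟨a.1, hc0.symm⟩)
  let σ := univBall (0 : EuclideanSpace ℝ (Fin n)) ε
  have hσ : ∀ b, σ b ∈ Metric.ball 0 ε := fun b => by
    rw [← univBall_target _ hε]
    exact σ.map_source (by simp [σ])
  have hCσ : IsDChart (C ∘ σ) (σ.symm ∘ R) := hC.comp σ (by simp [σ]) contDiff_univBall (by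
    rw [univBall_target _ hε]
    exact contDiffOn_univBall_symm)
  let χ := π ∘ C ∘ σ
  have hχ : DSmooth χ := hπ.isLocalSubduction.1.comp hCσ.dSmooth
  have hF := hΦ.chart_base.contDiff_comp (p := f ∘ χ) (hf.comp hχ).isPlot fun b => hball _ (hσ b)
  obtain ⟨Ψ, hΨ, hΨl, hΨq, hΨeq⟩ := hΦ.exists_chart_fiberProd hχ
    (hπ.isLocalSubduction.liftsThrough.comp hCσ.liftsThrough)
    (fun b => hπ.isQuasiEtaleAt hCσ b) hF
    fun b => hΦ.chart_base.right_inv (hball _ (hσ b))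
  obtain ⟨e⟩ := exists_prodEquiv n k
  refine ⟨n + k, Ψ ∘ e, hΨ.comp e.contDiff.dSmooth, hΨl.comp e.liftsThrough,
    IsQuasiEtaleAt.comp_equiv hΨ hΨl hΨq e, e.symm (0, a.2), Subtype.ext ?_⟩
  have hσ0 : σ 0 = 0 := by simp [σ]
  have hχ0 : χ 0 = x.1.2 := by simp only [χ, Function.comp_apply, hσ0, hC0, hy]
  have hF0 : (r ∘ f ∘ χ) 0 = a.1 := by
    simp only [χ, Function.comp_apply, hσ0, hc0, hΦ.chart_base.left_inv]
  rw [Function.comp_apply, e.apply_symm_apply, hΨeq, hF0, hχ0, Prod.mk.eta, ha]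

end QUED

section Pullbacks

variable {X Y M : Type u} [DiffeologicalSpace X] [DiffeologicalSpace Y] [DiffeologicalSpace M]

/-- If the fiber product of diffeological spaces is a `QUED`, it is the fiber product in the
category. -/
theorem hasPullback_of_isQUED_fiberProd {A B C : QUED.{u}} (p : A ⟶ C) (f : B ⟶ C)
    (h : IsQUED (FiberProd p.hom.toFun f.hom.toFun)) : HasPullback p f := by
  let P : QUED.{u} := QUED.of _ h
  let fst : P ⟶ A := ObjectProperty.homMk ⟨fun z => z.1.1, dSmooth_fst.comp dSmooth_subtypeVal⟩
  let snd : P ⟶ B := ObjectProperty.homMk ⟨fun z => z.1.2, dSmooth_snd.comp dSmooth_subtypeVal⟩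
  have eq : fst ≫ p = snd ≫ f := by
    refine ObjectProperty.hom_ext _ (Diffgl.Hom.ext ?_)
    funext z
    exact z.2
  have hcomm (s : PullbackCone p f) (z : s.pt.obj.carrier) :
      p.hom.toFun (s.fst.hom.toFun z) = f.hom.toFun (s.snd.hom.toFun z) :=
    congrArg (fun g => g.hom.toFun z) s.condition
  refine ⟨⟨⟨_, PullbackCone.IsLimit.mk eq (fun s => ObjectProperty.homMk
    ⟨fun z => ⟨(s.fst.hom.toFun z, s.snd.hom.toFun z), hcomm s z⟩,
      dSmooth_subtype_iff.2 (s.fst.hom.smooth.prodMk s.snd.hom.smooth)⟩)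
    (fun s => rfl) (fun s => rfl) fun s m h1 h2 => ?_⟩⟩⟩
  refine ObjectProperty.hom_ext _ (Diffgl.Hom.ext ?_)
  funext z
  refine Subtype.ext (Prod.ext ?_ ?_)
  · exact congrArg (fun g => g.hom.toFun z) h1
  · exact congrArg (fun g => g.hom.toFun z) h2

/-- The fiber products along a map with fibered charts all exist, so that the first alternative in
the definition of a cartesian morphism always holds. -/
theorem HasFiberedCharts.isQUEDSubmersion {p : X → M} {m k : ℕ} (h : HasFiberedCharts p m k)
    (hM : IsQUED M) (hp : IsLocalSubduction p) : IsQUEDSubmersion p :=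
  ⟨h.isQUED, hM, hp.1, hp, fun Y f =>
    Or.inl (hasPullback_of_isQUED_fiberProd _ f (h.isQUED_fiberProd Y.property f.hom.smooth))⟩

end Pullbacks

/-! ### Translation to all arrows -/

namespace DiffeologicalGroupoid

section Translation

variable {V W G M X : Type*}
  [NormedAddCommGroup V] [NormedSpace ℝ V] [FiniteDimensional ℝ V]
  [DiffeologicalSpace V] [IsContDiffCompatible V]
  [NormedAddCommGroup W] [NormedSpace ℝ W] [FiniteDimensional ℝ W]
  [DiffeologicalSpace W] [IsContDiffCompatible W]
  [DiffeologicalSpace G] [DiffeologicalSpace M] [DiffeologicalSpace X]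
  (𝒢 : DiffeologicalGroupoid G M)

open Classical in
/-- The product of two arrows, extended to all pairs: the value at a pair of arrows that are not
composable is the first of them. -/
noncomputable def prod (g h : G) : G :=
  if e : 𝒢.src g = 𝒢.tgt h then 𝒢.mul ⟨(g, h), e⟩ else g

variable {g h : G}

theorem prod_eq (e : 𝒢.src g = 𝒢.tgt h) : 𝒢.prod g h = 𝒢.mul ⟨(g, h), e⟩ :=
  dif_pos e

theorem src_prod (e : 𝒢.src g = 𝒢.tgt h) : 𝒢.src (𝒢.prod g h) = 𝒢.src h := by
  rw [𝒢.prod_eq e, 𝒢.src_mul]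

theorem prod_assoc {k : G} (e : 𝒢.src g = 𝒢.tgt h) (e' : 𝒢.src h = 𝒢.tgt k) :
    𝒢.prod (𝒢.prod g h) k = 𝒢.prod g (𝒢.prod h k) := by
  simp only [𝒢.prod_eq e, 𝒢.prod_eq e']
  rw [𝒢.prod_eq ((𝒢.src_mul _).trans e'), 𝒢.prod_eq (e.trans (𝒢.tgt_mul ⟨(h, k), e'⟩).symm), 𝒢.assoc]

theorem prod_unit {x : M} (hx : 𝒢.src g = x) : 𝒢.prod g (𝒢.unit x) = g := by
  subst hx
  rw [𝒢.prod_eq (𝒢.tgt_unit _).symm, 𝒢.mul_unit]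

theorem unit_prod {x : M} (hx : 𝒢.tgt g = x) : 𝒢.prod (𝒢.unit x) g = g := by
  subst hx
  rw [𝒢.prod_eq (𝒢.src_unit _), 𝒢.unit_mul]

theorem prod_prod_inv (e : 𝒢.src g = 𝒢.tgt h) : 𝒢.prod (𝒢.prod g h) (𝒢.inv h) = g := by
  rw [𝒢.prod_assoc e (𝒢.tgt_inv h).symm, 𝒢.prod_eq (𝒢.tgt_inv h).symm, 𝒢.mul_inv,
    𝒢.prod_unit e]

theorem prod_inv_prod (e : 𝒢.src g = 𝒢.src h) : 𝒢.prod (𝒢.prod g (𝒢.inv h)) h = g := by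
  rw [𝒢.prod_assoc (e.trans (𝒢.tgt_inv h).symm) (𝒢.src_inv h), 𝒢.prod_eq (𝒢.src_inv h),
    𝒢.inv_mul, 𝒢.prod_unit e]

theorem inv_inv (g : G) : 𝒢.inv (𝒢.inv g) = g := by
  have e : 𝒢.src g = 𝒢.tgt (𝒢.inv g) := (𝒢.tgt_inv g).symm
  rw [← 𝒢.prod_unit (g := 𝒢.inv (𝒢.inv g)) rfl, 𝒢.src_inv, 𝒢.tgt_inv, ← 𝒢.inv_mul g,
    ← 𝒢.prod_eq (𝒢.src_inv g), ← 𝒢.prod_assoc (𝒢.src_inv _) (𝒢.src_inv g),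
    𝒢.prod_eq (𝒢.src_inv _), 𝒢.inv_mul, 𝒢.src_inv, 𝒢.unit_prod rfl]

theorem dSmooth_prod {f₁ f₂ : X → G} (hf₁ : DSmooth f₁) (hf₂ : DSmooth f₂)
    (e : ∀ x, 𝒢.src (f₁ x) = 𝒢.tgt (f₂ x)) : DSmooth fun x => 𝒢.prod (f₁ x) (f₂ x) := by
  have h1 : (fun x => 𝒢.prod (f₁ x) (f₂ x)) =
      fun x => 𝒢.mul ⟨(f₁ x, f₂ x), e x⟩ := funext fun x => 𝒢.prod_eq (e x)
  rw [h1]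
  exact 𝒢.smooth_mul.comp (dSmooth_subtype_iff.2 (hf₁.prodMk hf₂))

theorem liftsThrough_inv : LiftsThrough Set.univ 𝒢.inv := fun _ p hp _ v a ha =>
  ⟨𝒢.inv ∘ p, 𝒢.smooth_inv _ _ hp, by rw [Function.comp_apply, ha, 𝒢.inv_inv],
    by simp [𝒢.inv_inv]⟩

/-- The target map is a local subduction if the source map is. -/
theorem isLocalSubduction_tgt (hs : IsLocalSubduction 𝒢.src) : IsLocalSubduction 𝒢.tgt := by
  have h1 : 𝒢.src ∘ 𝒢.inv = 𝒢.tgt := funext 𝒢.src_inv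
  rw [← h1]
  exact (hs.liftsThrough.comp 𝒢.liftsThrough_inv).isLocalSubduction (hs.1.comp 𝒢.smooth_inv)

/-- Charts of the arrows near the unit over each object, in which the source map is a projection,
and which are quasi-étale at the unit along its source fiber. -/
def HasUnitCharts (V W : Type*) [NormedAddCommGroup V] [NormedSpace ℝ V]
    [DiffeologicalSpace V] [NormedAddCommGroup W] [NormedSpace ℝ W]
    [DiffeologicalSpace W] : Prop :=
  ∀ y : M, ∃ (c : V → M) (r : M → V) (Φ : V × W → G), IsDChart c r ∧ DSmooth Φ ∧
    LiftsThrough Set.univ Φ ∧ (∀ v w, 𝒢.src (Φ (v, w)) = c v) ∧ c 0 = y ∧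
    Φ (0, 0) = 𝒢.unit y ∧ IsQuasiEtaleAt (fun w => Φ (0, w)) 0

variable {𝒢}

/-- Along source fibers, any chart of the right dimension is quasi-étale everywhere: it can be
compared with a right translate of a chart near a unit. -/
theorem HasUnitCharts.isQuasiEtaleAt (H : 𝒢.HasUnitCharts V W) {f : W → G} (hf : DSmooth f)
    {x : M} (hfx : ∀ w, 𝒢.src (f w) = x) (hl : LiftsThrough (𝒢.src ⁻¹' {x}) f) (w : W) :
    IsQuasiEtaleAt f w := by
  obtain ⟨c, r, Φ, hc, hΦ, hΦl, hΦs, hc0, hΦ0, hΦq⟩ := H (𝒢.tgt (f w))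
  have hslice : DSmooth fun z : W => Φ (0, z) :=
    hΦ.comp (ContDiff.dSmooth (f := fun z : W => ((0 : V), z)) (by fun_prop))
  have hcomp : ∀ z, 𝒢.src (Φ (0, z)) = 𝒢.tgt (f w) := fun z => (hΦs 0 z).trans hc0
  have hχ : DSmooth fun z => 𝒢.prod (Φ (0, z)) (f w) :=
    𝒢.dSmooth_prod hslice (dSmooth_const (y := f w)) hcomp
  refine IsQuasiEtaleAt.of_liftsThrough (S := 𝒢.src ⁻¹' {x})
    (χ := fun z => 𝒢.prod (Φ (0, z)) (f w)) (b := 0) ?_ hf hχ hfx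
    (fun z => (𝒢.src_prod (hcomp z)).trans (hfx w)) hl ?_ ?_ rfl
  · refine IsQuasiEtaleAt.of_comp (g := fun k => 𝒢.prod k (𝒢.inv (f w))) ?_
    have h1 : (fun k => 𝒢.prod k (𝒢.inv (f w))) ∘ (fun z => 𝒢.prod (Φ (0, z)) (f w)) =
        fun z => Φ (0, z) := funext fun z => 𝒢.prod_prod_inv (hcomp z)
    rwa [h1]
  · intro n p hp hpx v a ha
    have hcp : ∀ z, 𝒢.src (p z) = 𝒢.src (f w) := fun z =>
      (show 𝒢.src (p z) = x from hpx z).trans (hfx w).symm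
    have hcp' : ∀ z, 𝒢.src (p z) = 𝒢.tgt (𝒢.inv (f w)) := fun z =>
      (hcp z).trans (𝒢.tgt_inv _).symm
    obtain ⟨q, hq, hqv, hΦq⟩ := hΦl.slice hc.injective hΦs 0 n
      (fun z => 𝒢.prod (p z) (𝒢.inv (f w)))
      (𝒢.dSmooth_prod hp.dSmooth (dSmooth_const (y := 𝒢.inv (f w))) hcp').isPlot
      (fun z => by
        rw [Set.mem_preimage, 𝒢.src_prod (hcp' z), 𝒢.src_inv, hc0]
        rfl) v a (by
        simp only [ha]
        exact 𝒢.prod_prod_inv (hcomp a))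
    refine ⟨q, hq, hqv, ?_⟩
    filter_upwards [hΦq] with z hz
    rw [hz, 𝒢.prod_inv_prod (hcp z)]
  · simp only [hΦ0]
    exact (𝒢.unit_prod rfl).symm

end Translation

section Charts

open OpenPartialHomeomorph

variable {G M : Type u} [DiffeologicalSpace G] [DiffeologicalSpace M]
  {𝒢 : DiffeologicalGroupoid G M}

/-- Right translation of the charts near the units along local sections of the source map provides
fibered charts of the source map everywhere. -/
theorem HasUnitCharts.hasFiberedCharts_src {m k : ℕ}
    (H : 𝒢.HasUnitCharts (EuclideanSpace ℝ (Fin m)) (EuclideanSpace ℝ (Fin k)))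
    (hs : IsLocalSubduction 𝒢.src) : HasFiberedCharts 𝒢.src m k := by
  intro g
  obtain ⟨c₁, r₁, -, hc₁, -, -, -, hc₁0, -⟩ := H (𝒢.src g)
  obtain ⟨c, r, Φ, hc, hΦ, hΦl, hΦs, hc0, hΦ0, -⟩ := H (𝒢.tgt g)
  obtain ⟨τ, hτ, hτ0, hsτ⟩ := hs.liftsThrough.exists_lift hc₁.dSmooth (v := 0) (a := g)
    (by simp) hc₁0
  obtain ⟨ε, hε, hball⟩ := Metric.eventually_nhds_iff_ball.1 (hsτ.and
    (hc.isDOpen_range.eventually (𝒢.smooth_tgt.comp hτ) (v := 0)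
      ⟨0, by rw [hc0, Function.comp_apply, hτ0]⟩))
  -- Shrink the section to a ball, which is identified with the whole space.
  let β := univBall (0 : EuclideanSpace ℝ (Fin m)) ε
  have hβ : ∀ b, β b ∈ Metric.ball 0 ε := fun b => by
    rw [← univBall_target _ hε]
    exact β.map_source (by simp [β])
  have hcβ : IsDChart (c₁ ∘ β) (β.symm ∘ r₁) := hc₁.comp β (by simp [β]) contDiff_univBall (by
    rw [univBall_target _ hε]
    exact contDiffOn_univBall_symm)
  let σ := τ ∘ β
  have hσ : DSmooth σ := hτ.comp (ContDiff.dSmooth contDiff_univBall)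
  have hσs : ∀ v, 𝒢.src (σ v) = (c₁ ∘ β) v := fun v => (hball _ (hβ v)).1
  let θ := r ∘ 𝒢.tgt ∘ σ
  have hθ : ContDiff ℝ ∞ θ := hc.contDiff_comp (p := 𝒢.tgt ∘ σ) (𝒢.smooth_tgt.comp hσ).isPlot
    fun v => (hball _ (hβ v)).2
  have hcθ : ∀ v, c (θ v) = 𝒢.tgt (σ v) := fun v => hc.right_inv (hball _ (hβ v)).2
  have hcomp : ∀ v w, 𝒢.src (Φ (θ v, w)) = 𝒢.tgt (σ v) := fun v w =>
    (hΦs _ _).trans (hcθ v)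
  let Ψ : EuclideanSpace ℝ (Fin m) × EuclideanSpace ℝ (Fin k) → G :=
    fun z => 𝒢.prod (Φ (θ z.1, z.2)) (σ z.1)
  have hΨ : DSmooth Ψ := 𝒢.dSmooth_prod
    (hΦ.comp ((hθ.comp contDiff_fst).prodMk contDiff_snd).dSmooth)
    (hσ.comp contDiff_fst.dSmooth) fun z => hcomp z.1 z.2
  have hΨs : ∀ v w, 𝒢.src (Ψ (v, w)) = (c₁ ∘ β) v := fun v w =>
    (𝒢.src_prod (hcomp v w)).trans (hσs v)
  have hΨl : LiftsThrough Set.univ Ψ := by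
    intro n p hp _ x ⟨v, w⟩ hx
    obtain ⟨q, hq, hqx, hcq⟩ := hcβ.exists_lift (𝒢.smooth_src.comp hp.dSmooth) (v := x) (a := v)
      (by rw [Function.comp_apply, hx, hΨs])
    have hcomp' : ∀ᶠ z in 𝓝 x, 𝒢.src (p z) = 𝒢.src (σ (q z)) := by
      filter_upwards [hcq] with z hz
      rw [hσs, hz, Function.comp_apply]
    obtain ⟨ρ, hρ, hρc, hρx⟩ := exists_smooth_retraction_near x hcomp'
    have hcomp'' : ∀ z, 𝒢.src (p (ρ z)) = 𝒢.tgt (𝒢.inv (σ (q (ρ z)))) := fun z =>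
      (show 𝒢.src (p (ρ z)) = _ from hρc z).trans (𝒢.tgt_inv _).symm
    obtain ⟨s, hs, hsx, hΦs'⟩ := hΦl n
      (fun z => 𝒢.prod (p (ρ z)) (𝒢.inv (σ (q (ρ z)))))
      (𝒢.dSmooth_prod (hp.dSmooth.comp hρ.dSmooth)
        (𝒢.smooth_inv.comp (hσ.comp (hq.comp hρ).dSmooth)) hcomp'').isPlot
      (fun _ => Set.mem_univ _) x (θ v, w) (by
        simp only [hρx.self_of_nhds, hqx, hx]
        exact 𝒢.prod_prod_inv (hcomp v w))
    refine ⟨fun z => (q z, (s z).2), (hq.dSmooth.prodMk (dSmooth_snd.comp hs.dSmooth)).isPlot,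
      by simp only [hqx, hsx], ?_⟩
    filter_upwards [hΦs', hρx] with z h1 h2
    have h3 : (s z).1 = θ (q z) := hc.injective (by
      rw [← hΦs (s z).1 (s z).2, Prod.mk.eta, h1, 𝒢.src_prod (hcomp'' z), 𝒢.src_inv, hcθ, h2])
    have h4 : Φ (θ (q z), (s z).2) = Φ (s z) := congrArg Φ (Prod.ext h3.symm rfl)
    have h5 : 𝒢.src (p z) = 𝒢.src (σ (q z)) := by
      have h6 : 𝒢.src (p (ρ z)) = 𝒢.src (σ (q (ρ z))) := hρc z
      rwa [h2] at h6
    simp only [Ψ]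
    rw [h4, h1, h2, 𝒢.prod_inv_prod h5]
  refine ⟨_, _, Ψ, ⟨hcβ, hΨ, hΨl, hΨs, fun v w => ?_⟩, (0, 0), ?_⟩
  · exact H.isQuasiEtaleAt
      (hΨ.comp (ContDiff.dSmooth (f := fun z => (v, z)) (by fun_prop))) (hΨs v)
      (hΨl.slice hcβ.injective hΨs v) w
  · have h1 : σ 0 = g := by simp [σ, β, hτ0]
    have h2 : θ 0 = 0 := hc.injective (by rw [hcθ, h1, hc0])
    simp only [Ψ, h1, h2, hΦ0]
    exact 𝒢.unit_prod rfl

theorem hasFiberedCharts_tgt {m k : ℕ} (h : HasFiberedCharts 𝒢.src m k) :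
    HasFiberedCharts 𝒢.tgt m k := by
  intro g
  obtain ⟨c, r, Φ, hΦ, a, ha⟩ := h (𝒢.inv g)
  refine ⟨c, r, 𝒢.inv ∘ Φ, ⟨hΦ.chart_base, 𝒢.smooth_inv.comp hΦ.dSmooth,
    𝒢.liftsThrough_inv.comp hΦ.liftsThrough, fun v w => (𝒢.tgt_inv _).trans (hΦ.comm v w),
    fun v w => ?_⟩, a, by rw [Function.comp_apply, ha, 𝒢.inv_inv]⟩
  refine IsQuasiEtaleAt.of_comp (g := 𝒢.inv) ?_
  have h1 : (𝒢.inv ∘ fun w => (𝒢.inv ∘ Φ) (v, w)) = fun w => Φ (v, w) :=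
    funext fun w => 𝒢.inv_inv _
  rw [h1]
  exact hΦ.isQuasiEtaleAt_slice v w

end Charts

end DiffeologicalGroupoid

theorem mainTheorem7 {G G' M : Type u} [DiffeologicalSpace G] [DiffeologicalSpace G']
    [DiffeologicalSpace M] (hM : IsSmoothManifold M)
    (𝒢 : DiffeologicalGroupoid G M) (hs : IsLocalSubduction 𝒢.src)
    (𝒢' : LocalDiffeologicalGroupoid G' M) (h𝒢' : 𝒢'.IsLocalLieGroupoid)
    (π : G' → G) (hπ : IsLocalSubduction π) (hπ' : 𝒢'.IsGermMorphism 𝒢.toLocal π id)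
    (hfib : ∀ x : M, IsDTotallyDisconnected (π ⁻¹' {𝒢.unit x})) :
    𝒢.IsQUEDGroupoid ∧ 𝒢'.IsWideLocalLieGroupoidChart 𝒢.toLocal π := by
  obtain ⟨m, _, _, -, -, _, hMp⟩ := id hM
  obtain ⟨d, _, _, -, -, _, hGp⟩ := id h𝒢'.2.1
  have hMc := exists_isDChart_of_isManifold hMp
  have hGc := exists_isDChart_of_isManifold hGp
  obtain ⟨S, hS, hSu, hπu, hπs, -, -⟩ := hπ'.exists_isDOpen
  have hunit (y : M) : m ≤ d ∧ ∃ (c : EuclideanSpace ℝ (Fin m) → M)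
      (r : M → EuclideanSpace ℝ (Fin m))
      (Φ : EuclideanSpace ℝ (Fin m) × EuclideanSpace ℝ (Fin (d - m)) → G), IsDChart c r ∧
      DSmooth Φ ∧ LiftsThrough Set.univ Φ ∧ (∀ v w, 𝒢.src (Φ (v, w)) = c v) ∧ c 0 = y ∧
      Φ (0, 0) = 𝒢.unit y ∧ IsQuasiEtaleAt (fun w => Φ (0, w)) 0 := by
    obtain ⟨c₀, r₀, hc₀, rfl⟩ := hMc y
    obtain ⟨C, R, hC, hC0⟩ := hGc (𝒢'.unit (c₀ 0))
    obtain ⟨hmd, c, r, ψ, ρ, hc, hψ, hc0, hψs, hψu, hψS⟩ := exists_isDChart_of_section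
      𝒢'.smooth_src 𝒢'.smooth_unit 𝒢'.src_unit hc₀ hC hC0 hS (by rw [hC0]; exact hSu _)
    refine ⟨hmd, c, r, π ∘ ψ, hc, hπ.1.comp hψ.dSmooth, hπ.liftsThrough.comp hψ.liftsThrough,
      fun v w => (hπs _ (hψS _)).trans (hψs v w), hc0, ?_, ?_⟩
    · rw [Function.comp_apply, hψu, hπu, hc0]
    · exact LocalDiffeologicalGroupoid.IsSourceChart.isQuasiEtaleAt ⟨hc, hψ, hψs, hψu⟩ hπ' hfib
  have hsrc : HasFiberedCharts 𝒢.src m (d - m) :=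
    DiffeologicalGroupoid.HasUnitCharts.hasFiberedCharts_src (fun y => (hunit y).2) hs
  have hMQ : IsQUED M := isQUED_of_exists_isDChart hMc
  have hQ : 𝒢.IsQUEDGroupoid := ⟨hsrc.isQUED, hMQ, hsrc.isQUEDSubmersion hMQ hs,
    (DiffeologicalGroupoid.hasFiberedCharts_tgt hsrc).isQUEDSubmersion hMQ
      (𝒢.isLocalSubduction_tgt hs)⟩
  refine ⟨hQ, ⟨⟨⟨hQ.arrows, hQ.objects, hQ.src, hQ.tgt⟩, hM⟩, h𝒢', ?_, hπ'⟩⟩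
  refine hπ.isQuasiEtale (V := EuclideanSpace ℝ (Fin d)) (fun x => ?_) fun c r hc a => ?_
  · obtain ⟨c, r, hc, hcx⟩ := hGc x
    exact ⟨c, r, 0, hc, hcx⟩
  · -- Compare `π` with a chart of `G` of the same dimension.
    obtain ⟨c₁, r₁, Φ, hΦ, b, hb⟩ := hsrc (π (c a))
    have hmd := (hunit (𝒢.src (π (c a)))).1
    exact (hΦ.isQuasiEtaleAt b).of_liftsThrough (hπ.1.comp hc.dSmooth) hΦ.dSmooth
      (fun _ => Set.mem_univ _) (fun _ => Set.mem_univ _)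
      (hπ.liftsThrough.comp hc.liftsThrough) hΦ.liftsThrough hb.symm (by simp; omega)
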